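/- Work over $\mathbb{C}$, in the symmetric monoidal category of $(\mathbb{Z},\mathbb{Z})$-bigraded vector spaces, where the Koszul signs are taken with respect to the first degree only. An operad $P$ is a functor from finite sets and bijections to this category with a unit in $P(\{\star\})$ and composition maps $\circ_\star : P(I\sqcup\{\star\})\otimes P(J)\to P(I\sqcup J)$ satisfying the usual equivariance, unit, sequential and parallel associativity axioms. Let $\mathrm{Ram}$ be the operad generated by $E_{i,j}$ symmetric of degree $(0,0)$, $L_{i,j}$ antisymmetric of degree $(0,1)$ and $\Omega_{i,j}$ antisymmetric of degree $(1,1)$, modulo the relations (sums over the cyclic permutations of $i,j,k$) $$\sum_{cycl} L_{i,\star}\circ_\star L_{j,k}=0,\qquad \sum_{cycl}\left(\Omega_{i,\star}\circ_\star L_{j,k}+L_{i,\star}\circ_\star\Omega_{j,k}\right)=0,\qquad E_{i,\star}\circ_\star E_{j,k}=E_{j,\star}\circ_\star E_{k,i},$$ $$L_{i,\star}\circ_\star E_{j,k}=E_{j,\star}\circ_\star L_{i,k}+E_{k,\star}\circ_\star L_{i,j},\qquad \Omega_{i,\star}\circ_\star E_{j,k}=E_{j,\star}\circ_\star\Omega_{i,k}+E_{k,\star}\circ_\star\Omega_{i,j}.$$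 A derivation of bidegree $\delta$ of an operad is a family of linear maps of bidegree $\delta$ that commutes with relabelling and satisfies $D(x\circ_\star y)=D(x)\circ_\star y+(-1)^{\delta_1|x|}x\circ_\star D(y)$, where $\delta_1$ and $|x|$ are first degrees. A Hopf operad is an operad together with coassociative counital coalgebra structures of degree $(0,0)$ on the spaces $P(I)$, such that relabelling, unit and composition are morphisms of coalgebras. Then: 1. There is a unique derivation $D'$ of $\mathrm{Ram}$ of bidegree $(1,0)$ with $D'(E_{i,j})=0$, $D'(L_{i,j})=\Omega_{i,j}$, $D'(\Omega_{i,j})=0$. 2. There is a unique derivation $D$ of $\mathrm{Ram}$ of bidegree $(-1,0)$ with $D(E_{i,j})=0$, $D(\Omega_{i,j})=L_{i,j}$, $D(L_{i,j})=0$. 3. There is a unique Hopf operad structure on $\mathrm{Ram}$ whose coproduct satisfies $\Delta(E_{i,j})=E_{i,j}\otimes E_{i,j}$, $\Delta(L_{i,j})=E_{i,j}\otimes L_{i,j}+L_{i,j}\otimes E_{i,j}$ and $\Delta(\Omega_{i,j})=E_{i,j}\otimes\Omega_{i,j}+\Omega_{i,j}\otimes E_{i,j}$. 4. $D$ and $D'$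 are coderivations for this coproduct, that is, $\Delta D=(D\otimes 1+1\otimes D)\Delta$ and $\Delta D'=(D'\otimes 1+1\otimes D')\Delta$ with the Koszul sign $(1\otimes D)(x\otimes y)=(-1)^{|x|}x\otimes D(y)$, and likewise for $D'$. Moreover $D^2=0$ and $D'^2=0$, and both vanish on the operad unit and are annihilated by the counit ($\varepsilon D=\varepsilon D'=0$). Hence $\mathrm{Ram}$ is a Hopf operad in the category of $(\mathbb{Z},\mathbb{Z})$-bigraded vector spaces endowed with two differentials of degrees $(1,0)$ and $(-1,0)$. -/

import Mathlib

open scoped TensorProduct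

universe u

namespace Ramanujan

/-! ### Relabelling bijections

`Option I` is `I ⊔ {⋆}`, with `none` as the place-holder, and `I ⊕ J` is the disjoint union. -/

/-- `I ⊔ (J ⊔ {⋆}) ≃ (I ⊔ J) ⊔ {⋆}`. -/
def starRight (I J : Type) : I ⊕ Option J ≃ Option (I ⊕ J) where
  toFun
    | .inl i => some (.inl i)
    | .inr none => none
    | .inr (some j) => some (.inr j)
  invFun
    | none => .inr none
    | some (.inl i) => .inl i
    | some (.inr j) => .inr (some j)
  left_inv := by rintro (i | _ | j) <;> rfl
  right_inv := by rintro (_ | i | j) <;> rfl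

/-- `(I ⊔ {⋆}) ⊔ J ≃ (I ⊔ J) ⊔ {⋆}`. -/
def starLeft (I J : Type) : Option I ⊕ J ≃ Option (I ⊕ J) where
  toFun
    | .inl none => none
    | .inl (some i) => some (.inl i)
    | .inr j => some (.inr j)
  invFun
    | none => .inl none
    | some (.inl i) => .inl (some i)
    | some (.inr j) => .inr j
  left_inv := by rintro ((_ | i) | j) <;> rfl
  right_inv := by rintro (_ | i | j) <;> rfl

/-- The exchange of the two place-holders in `I ⊔ {#} ⊔ {⋆}`. -/
def swapStars (I : Type) : Option (Option I) ≃ Option (Option I) where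
  toFun
    | none => some none
    | some none => none
    | some (some i) => some (some i)
  invFun
    | none => some none
    | some none => none
    | some (some i) => some (some i)
  left_inv := by rintro (_ | _ | i) <;> rfl
  right_inv := by rintro (_ | _ | i) <;> rfl

/-- `(I ⊔ K) ⊔ J ≃ (I ⊔ J) ⊔ K`. -/
def exchange (I J K : Type) : (I ⊕ K) ⊕ J ≃ (I ⊕ J) ⊕ K :=
  (Equiv.sumAssoc I K J).trans
    ((Equiv.sumCongr (Equiv.refl I) (Equiv.sumComm K J)).trans (Equiv.sumAssoc I J K).symm)

/-- A one-point set is `∅ ⊔ {⋆}`. -/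
def unitStar : Unit ≃ Option Empty where
  toFun _ := none
  invFun _ := ()
  left_inv _ := rfl
  right_inv := by rintro (_ | ⟨⟨⟩⟩); rfl

/-- The two-element set `{0, 1}` as `{i} ⊔ {⋆}`, with `0 ↦ i` and `1 ↦ ⋆`. -/
def pairStar : Fin 2 ≃ Option Unit where
  toFun a := if a = 0 then some () else none
  invFun
    | none => 1
    | some _ => 0
  left_inv := by intro a; fin_cases a <;> rfl
  right_inv := by rintro (_ | _) <;> rfl

/-! ### Operads in bigraded vector spaces -/

/-- An operad, as a functor on finite sets and bijections with partial composition maps `∘_⋆`, in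
the category of `(ℤ, ℤ)`-bigraded complex vector spaces whose symmetry isomorphism carries the
Koszul sign of the first degree. -/
structure BigradedOperad where
  /-- The vector space attached to a finite set. -/
  obj : (I : Type) → [Finite I] → Type u
  [addCommGroup : ∀ (I : Type) [Finite I], AddCommGroup (obj I)]
  [module : ∀ (I : Type) [Finite I], Module ℂ (obj I)]
  /-- The component of each bidegree. -/
  gr : ∀ (I : Type) [Finite I], ℤ × ℤ → Submodule ℂ (obj I)
  /-- Each space is the direct sum of its components. -/
  [decomposition : ∀ (I : Type) [Finite I], DirectSum.Decomposition (gr I)]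
  /-- The action of bijections. -/
  map : ∀ {I J : Type} [Finite I] [Finite J], (I ≃ J) → (obj I →ₗ[ℂ] obj J)
  /-- The unit. -/
  one : obj Unit
  /-- The composition map `∘_⋆`. -/
  comp : ∀ {I J : Type} [Finite I] [Finite J],
    obj (Option I) →ₗ[ℂ] obj J →ₗ[ℂ] obj (I ⊕ J)
  map_mem : ∀ {I J : Type} [Finite I] [Finite J] (e : I ≃ J) {d : ℤ × ℤ} {x : obj I},
    x ∈ gr I d → map e x ∈ gr J d
  one_mem : one ∈ gr Unit 0
  comp_mem : ∀ {I J : Type} [Finite I] [Finite J] {d d' : ℤ × ℤ} {x : obj (Option I)}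
    {y : obj J}, x ∈ gr (Option I) d → y ∈ gr J d' → comp x y ∈ gr (I ⊕ J) (d + d')
  map_refl : ∀ {I : Type} [Finite I] (x : obj I), map (Equiv.refl I) x = x
  map_trans : ∀ {I J K : Type} [Finite I] [Finite J] [Finite K] (e : I ≃ J) (f : J ≃ K)
    (x : obj I), map (e.trans f) x = map f (map e x)
  comp_map : ∀ {I J I' J' : Type} [Finite I] [Finite J] [Finite I'] [Finite J']
    (e : I ≃ I') (f : J ≃ J') (x : obj (Option I)) (y : obj J),
    comp (map (Equiv.optionCongr e) x) (map f y) = map (Equiv.sumCongr e f) (comp x y)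
  comp_one : ∀ {I : Type} [Finite I] (x : obj (Option I)),
    comp x one = map (Equiv.optionEquivSumPUnit I) x
  one_comp : ∀ {J : Type} [Finite J] (y : obj J),
    comp (map unitStar one) y = map (Equiv.emptySum Empty J).symm y
  /-- Sequential composition: `(x ∘_⋆ y) ∘_# z = x ∘_⋆ (y ∘_# z)`. -/
  comp_assoc : ∀ {I J K : Type} [Finite I] [Finite J] [Finite K]
    (x : obj (Option I)) (y : obj (Option J)) (z : obj K),
    comp (map (starRight I J) (comp x y)) z =
      map (Equiv.sumAssoc I J K).symm (comp x (comp y z))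
  /-- Parallel composition: `(x ∘_⋆ y) ∘_# z = ± (x ∘_# z) ∘_⋆ y`, with the Koszul sign. -/
  comp_comm : ∀ {I J K : Type} [Finite I] [Finite J] [Finite K] {d d' : ℤ × ℤ}
    (x : obj (Option (Option I))) {y : obj J} {z : obj K}, y ∈ gr J d → z ∈ gr K d' →
    comp (map (starLeft I J) (comp x y)) z =
      ((-1 : ℂ) ^ (d.1 * d'.1)) •
        map (exchange I J K) (comp (map (starLeft I K) (comp (map (swapStars I) x) z)) y)

attribute [instance] BigradedOperad.addCommGroup BigradedOperad.module
  BigradedOperad.decomposition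

namespace BigradedOperad

variable (P : BigradedOperad.{u})

/-- A family of linear endomorphisms of the spaces of an operad. -/
abbrev EndoFamily : Type (max 1 u) :=
  ∀ (I : Type) [Finite I], P.obj I →ₗ[ℂ] P.obj I

/-- A family of coalgebra structures (coassociative, with counit) on the spaces of an operad. -/
abbrev CoalgebraFamily : Type (max 1 u) :=
  ∀ (I : Type) [Finite I], Coalgebra ℂ (P.obj I)

/-- The projection onto the components of odd first degree. -/
noncomputable def oddPart (I : Type) [Finite I] : P.obj I →ₗ[ℂ] P.obj I :=
  (DirectSum.toModule ℂ (ℤ × ℤ) (P.obj I)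
      fun d => if Odd d.1 then (P.gr I d).subtype else 0) ∘ₗ
    (DirectSum.decomposeLinearEquiv (P.gr I)).toLinearMap

/-- The parity involution `x ↦ (-1) ^ |x| x`, where `|x|` is the first degree. -/
noncomputable def parity (I : Type) [Finite I] : P.obj I →ₗ[ℂ] P.obj I :=
  LinearMap.id - (2 : ℂ) • P.oddPart I

theorem oddPart_of_mem {I : Type} [Finite I] {d : ℤ × ℤ} {x : P.obj I} (hx : x ∈ P.gr I d) :
    P.oddPart I x = if Odd d.1 then x else 0 := by
  simp only [oddPart, LinearMap.comp_apply, LinearEquiv.coe_coe,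
    DirectSum.decomposeLinearEquiv_apply, DirectSum.decompose_of_mem _ hx]
  erw [DirectSum.toModule_lof]
  split_ifs <;> rfl

theorem parity_of_mem {I : Type} [Finite I] {d : ℤ × ℤ} {x : P.obj I} (hx : x ∈ P.gr I d) :
    P.parity I x = ((-1 : ℂ) ^ d.1) • x := by
  rw [parity, LinearMap.sub_apply, LinearMap.smul_apply, P.oddPart_of_mem hx]
  rcases Int.even_or_odd d.1 with h | h
  · rw [if_neg (by simpa using h), h.neg_one_zpow]; simp
  · rw [if_pos h, h.neg_one_zpow, LinearMap.id_apply, two_smul, neg_smul, one_smul]; abel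

/-- The Koszul sign `y ⊗ x ↦ (-1) ^ (|y| |x|) y ⊗ x`. -/
noncomputable def koszulSign (I J : Type) [Finite I] [Finite J] :
    P.obj I ⊗[ℂ] P.obj J →ₗ[ℂ] P.obj I ⊗[ℂ] P.obj J :=
  LinearMap.id - (2 : ℂ) • TensorProduct.map (P.oddPart I) (P.oddPart J)

theorem koszulSign_of_mem {I J : Type} [Finite I] [Finite J] {d d' : ℤ × ℤ} {y : P.obj I}
    {x : P.obj J} (hy : y ∈ P.gr I d) (hx : x ∈ P.gr J d') :
    P.koszulSign I J (y ⊗ₜ x) = ((-1 : ℂ) ^ (d.1 * d'.1)) • (y ⊗ₜ x) := by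
  rw [koszulSign, LinearMap.sub_apply, LinearMap.smul_apply, TensorProduct.map_tmul,
    P.oddPart_of_mem hy, P.oddPart_of_mem hx]
  by_cases h : Odd d.1
  · by_cases h' : Odd d'.1
    · rw [if_pos h, if_pos h', (h.mul h').neg_one_zpow, LinearMap.id_apply, two_smul, neg_smul,
        one_smul]
      abel
    · rw [if_neg h', ((Int.not_odd_iff_even.1 h').mul_left _).neg_one_zpow]; simp
  · rw [if_neg h, ((Int.not_odd_iff_even.1 h).mul_right _).neg_one_zpow]; simp

/-- The composition map of the tensor square `P ⊗ P`:
`(x ⊗ y) ⊗ (x' ⊗ y') ↦ (-1) ^ (|y| |x'|) (x ∘_⋆ x') ⊗ (y ∘_⋆ y')`. -/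
noncomputable def tensorComp (I J : Type) [Finite I] [Finite J] :
    (P.obj (Option I) ⊗[ℂ] P.obj (Option I)) ⊗[ℂ] (P.obj J ⊗[ℂ] P.obj J) →ₗ[ℂ]
      P.obj (I ⊕ J) ⊗[ℂ] P.obj (I ⊕ J) :=
  TensorProduct.map (TensorProduct.lift P.comp) (TensorProduct.lift P.comp) ∘ₗ
    (TensorProduct.tensorTensorTensorComm ℂ (P.obj (Option I)) (P.obj (Option I))
      (P.obj J) (P.obj J)).toLinearMap ∘ₗ
    (TensorProduct.assoc ℂ (P.obj (Option I)) (P.obj (Option I))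
      (P.obj J ⊗[ℂ] P.obj J)).symm.toLinearMap ∘ₗ
    LinearMap.lTensor (P.obj (Option I))
      ((TensorProduct.assoc ℂ (P.obj (Option I)) (P.obj J) (P.obj J)).toLinearMap ∘ₗ
        LinearMap.rTensor (P.obj J) (P.koszulSign (Option I) J) ∘ₗ
        (TensorProduct.assoc ℂ (P.obj (Option I)) (P.obj J) (P.obj J)).symm.toLinearMap) ∘ₗ
    (TensorProduct.assoc ℂ (P.obj (Option I)) (P.obj (Option I))
      (P.obj J ⊗[ℂ] P.obj J)).toLinearMap

theorem tensorComp_of_mem {I J : Type} [Finite I] [Finite J] {d d' : ℤ × ℤ}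
    (x : P.obj (Option I)) {y : P.obj (Option I)} {x' : P.obj J} (y' : P.obj J)
    (hy : y ∈ P.gr (Option I) d) (hx' : x' ∈ P.gr J d') :
    P.tensorComp I J ((x ⊗ₜ y) ⊗ₜ (x' ⊗ₜ y')) =
      ((-1 : ℂ) ^ (d.1 * d'.1)) • (P.comp x x' ⊗ₜ[ℂ] P.comp y y') := by
  simp only [tensorComp, LinearMap.comp_apply, LinearEquiv.coe_coe, TensorProduct.assoc_tmul,
    LinearMap.lTensor_tmul, TensorProduct.assoc_symm_tmul, LinearMap.rTensor_tmul,
    P.koszulSign_of_mem hy hx', ← TensorProduct.smul_tmul', TensorProduct.tmul_smul, map_smul,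
    TensorProduct.tensorTensorTensorComm_tmul, TensorProduct.map_tmul, TensorProduct.lift.tmul]

/-- The component of bidegree `d` of `P(I) ⊗ P(I)`. -/
noncomputable def tensorGr (I : Type) [Finite I] (d : ℤ × ℤ) :
    Submodule ℂ (P.obj I ⊗[ℂ] P.obj I) :=
  ⨆ (a : ℤ × ℤ) (b : ℤ × ℤ) (_ : a + b = d),
    LinearMap.range (TensorProduct.mapIncl (P.gr I a) (P.gr I b))

/-- A derivation of bidegree `δ` for the composition. -/
structure IsDerivation (δ : ℤ × ℤ) (D : P.EndoFamily) : Prop where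
  map_mem : ∀ {I : Type} [Finite I] {d : ℤ × ℤ} {x : P.obj I},
    x ∈ P.gr I d → D I x ∈ P.gr I (d + δ)
  map_map : ∀ {I J : Type} [Finite I] [Finite J] (e : I ≃ J) (x : P.obj I),
    D J (P.map e x) = P.map e (D I x)
  leibniz : ∀ {I J : Type} [Finite I] [Finite J] {d : ℤ × ℤ} {x : P.obj (Option I)}
    (y : P.obj J), x ∈ P.gr (Option I) d →
    D (I ⊕ J) (P.comp x y) =
      P.comp (D (Option I) x) y + ((-1 : ℂ) ^ (δ.1 * d.1)) • P.comp x (D J y)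

/-- `P` with the given coproducts and counits is a Hopf operad: the coproducts and counits
preserve the bidegrees, and the structure maps of the operad are morphisms of coalgebras. -/
structure IsHopf (C : P.CoalgebraFamily) : Prop where
  comul_mem : ∀ {I : Type} [Finite I] {d : ℤ × ℤ} {x : P.obj I},
    x ∈ P.gr I d → (C I).comul x ∈ P.tensorGr I d
  counit_eq_zero : ∀ {I : Type} [Finite I] {d : ℤ × ℤ} {x : P.obj I},
    x ∈ P.gr I d → d ≠ 0 → (C I).counit x = 0
  comul_map : ∀ {I J : Type} [Finite I] [Finite J] (e : I ≃ J) (x : P.obj I),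
    (C J).comul (P.map e x) = TensorProduct.map (P.map e) (P.map e) ((C I).comul x)
  counit_map : ∀ {I J : Type} [Finite I] [Finite J] (e : I ≃ J) (x : P.obj I),
    (C J).counit (P.map e x) = (C I).counit x
  comul_one : (C Unit).comul P.one = P.one ⊗ₜ[ℂ] P.one
  counit_one : (C Unit).counit P.one = 1
  comul_comp : ∀ {I J : Type} [Finite I] [Finite J] (x : P.obj (Option I)) (y : P.obj J),
    (C (I ⊕ J)).comul (P.comp x y) =
      P.tensorComp I J ((C (Option I)).comul x ⊗ₜ (C J).comul y)
  counit_comp : ∀ {I J : Type} [Finite I] [Finite J] (x : P.obj (Option I)) (y : P.obj J),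
    (C (I ⊕ J)).counit (P.comp x y) = (C (Option I)).counit x * (C J).counit y

/-- The operator `D ⊗ 1 + 1 ⊗ D` on `P(I) ⊗ P(I)`, for `D` of odd first degree, so that
`(1 ⊗ D) (x ⊗ y) = (-1) ^ |x| x ⊗ D y` by the Koszul rule. -/
noncomputable def tensorEndo (D : P.EndoFamily) (I : Type) [Finite I] :
    P.obj I ⊗[ℂ] P.obj I →ₗ[ℂ] P.obj I ⊗[ℂ] P.obj I :=
  TensorProduct.map (D I) LinearMap.id + TensorProduct.map (P.parity I) (D I)

/-- A coderivation, of odd first degree, for the coproduct: `Δ D = (D ⊗ 1 + 1 ⊗ D) Δ`. -/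
def IsCoderivation (C : P.CoalgebraFamily) (D : P.EndoFamily) : Prop :=
  ∀ (I : Type) [Finite I] (x : P.obj I),
    (C I).comul (D I x) = P.tensorEndo D I ((C I).comul x)

/-- `P` is a Hopf operad in the category of bigraded vector spaces with two differentials, `D'` of
degree `(1, 0)` and `D` of degree `(-1, 0)`: it is a Hopf operad in bigraded vector spaces, the
endomorphisms are differentials, and all the structure maps (relabelling, unit, composition,
coproduct, counit) commute with both of them. -/
structure IsBidifferentialHopf (C : P.CoalgebraFamily) (D' D : P.EndoFamily) : Prop where
  isHopf : P.IsHopf C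
  isDerivation' : P.IsDerivation (1, 0) D'
  isDerivation : P.IsDerivation (-1, 0) D
  sq_zero' : ∀ (I : Type) [Finite I] (x : P.obj I), D' I (D' I x) = 0
  sq_zero : ∀ (I : Type) [Finite I] (x : P.obj I), D I (D I x) = 0
  map_one' : D' Unit P.one = 0
  map_one : D Unit P.one = 0
  isCoderivation' : P.IsCoderivation C D'
  isCoderivation : P.IsCoderivation C D
  counit_zero' : ∀ (I : Type) [Finite I] (x : P.obj I), (C I).counit (D' I x) = 0
  counit_zero : ∀ (I : Type) [Finite I] (x : P.obj I), (C I).counit (D I x) = 0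

end BigradedOperad

/-! ### The operad `Ram`, by generators and relations -/

/-- The generators. -/
inductive Gen
  | E
  | L
  | Ω

/-- The bidegrees of the generators. -/
def Gen.deg : Gen → ℤ × ℤ
  | .E => (0, 0)
  | .L => (0, 1)
  | .Ω => (1, 1)

/-- Formal operadic monomials in the generators, with inputs labelled by a finite set. -/
inductive Term : Type → Type 1
  | gen (g : Gen) : Term (Fin 2)
  | one : Term Unit
  | map {I J : Type} [Finite I] [Finite J] (e : I ≃ J) (t : Term I) : Term J
  | comp {I J : Type} [Finite I] [Finite J] (s : Term (Option I)) (t : Term J) : Term (I ⊕ J)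

/-- The bidegree of a monomial. -/
def Term.deg : {I : Type} → Term I → ℤ × ℤ
  | _, .gen g => g.deg
  | _, .one => 0
  | _, @Term.map _ _ _ _ _ t => t.deg
  | _, @Term.comp _ _ _ _ s t => s.deg + t.deg

/-- Formal linear combinations of monomials. -/
abbrev Poly (I : Type) : Type 1 := Term I →₀ ℂ

/-- A monomial as a linear combination. -/
noncomputable abbrev mono {I : Type} (t : Term I) : Poly I := Finsupp.single t 1

/-- Relabelling of linear combinations. -/
noncomputable def polyMap {I J : Type} [Finite I] [Finite J] (e : I ≃ J) :
    Poly I →ₗ[ℂ] Poly J :=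
  Finsupp.lmapDomain ℂ ℂ (Term.map e)

/-- Composition of linear combinations. -/
noncomputable def polyComp {I J : Type} [Finite I] [Finite J] :
    Poly (Option I) →ₗ[ℂ] Poly J →ₗ[ℂ] Poly (I ⊕ J) :=
  Finsupp.linearCombination ℂ fun s => Finsupp.lmapDomain ℂ ℂ (Term.comp s)

/-- The bijection from `{⋆} ⊔ {0, 1}` to `{0, 1, 2}` given by `⋆ ↦ i`, `0 ↦ j`, `1 ↦ k`. -/
noncomputable def tri (i j k : Fin 3)
    (h : Function.Bijective (Sum.elim (fun _ : Unit => i) ![j, k]) := by decide) :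
    Unit ⊕ Fin 2 ≃ Fin 3 :=
  Equiv.ofBijective _ h

/-- `quad g h (tri i j k)` is the monomial `g_{i,⋆} ∘_⋆ h_{j,k}` on the set `{0, 1, 2}`. -/
noncomputable def quad (g h : Gen) (e : Unit ⊕ Fin 2 ≃ Fin 3) : Poly (Fin 3) :=
  mono (Term.map e (Term.comp (Term.map pairStar (Term.gen g)) (Term.gen h)))

/-- The symmetries of the generators and the relations between them; an element `a` with
`RamRel a` is to become zero. -/
inductive RamRel : {I : Type} → Poly I → Prop
  | symm_E : RamRel
      (mono (Term.map (Equiv.swap 0 1) (Term.gen .E)) - mono (Term.gen .E))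
  | antisymm_L : RamRel
      (mono (Term.map (Equiv.swap 0 1) (Term.gen .L)) + mono (Term.gen .L))
  | antisymm_Ω : RamRel
      (mono (Term.map (Equiv.swap 0 1) (Term.gen .Ω)) + mono (Term.gen .Ω))
  | jacobi : RamRel
      (quad .L .L (tri 0 1 2) + quad .L .L (tri 1 2 0) + quad .L .L (tri 2 0 1))
  | mixed : RamRel
      ((quad .Ω .L (tri 0 1 2) + quad .L .Ω (tri 0 1 2)) +
        (quad .Ω .L (tri 1 2 0) + quad .L .Ω (tri 1 2 0)) +
        (quad .Ω .L (tri 2 0 1) + quad .L .Ω (tri 2 0 1)))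
  | assoc : RamRel (quad .E .E (tri 0 1 2) - quad .E .E (tri 1 2 0))
  | leibniz : RamRel
      (quad .L .E (tri 0 1 2) - (quad .E .L (tri 1 0 2) + quad .E .L (tri 2 0 1)))
  | bessel : RamRel
      (quad .Ω .E (tri 0 1 2) - (quad .E .Ω (tri 1 0 2) + quad .E .Ω (tri 2 0 1)))

/-- The smallest family of subspaces that is stable under relabelling and composition and contains
the relations together with the axioms of an operad. -/
inductive IsNull : {I : Type} → Poly I → Prop
  | rel {I : Type} {a : Poly I} : RamRel a → IsNull a
  | zero {I : Type} : IsNull (0 : Poly I)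
  | add {I : Type} {a b : Poly I} : IsNull a → IsNull b → IsNull (a + b)
  | smul {I : Type} (c : ℂ) {a : Poly I} : IsNull a → IsNull (c • a)
  | map {I J : Type} [Finite I] [Finite J] (e : I ≃ J) {a : Poly I} :
      IsNull a → IsNull (polyMap e a)
  | comp_left {I J : Type} [Finite I] [Finite J] {a : Poly (Option I)} (t : Term J) :
      IsNull a → IsNull (polyComp a (mono t))
  | comp_right {I J : Type} [Finite I] [Finite J] (s : Term (Option I)) {b : Poly J} :
      IsNull b → IsNull (polyComp (mono s) b)
  | map_refl {I : Type} [Finite I] (t : Term I) :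
      IsNull (mono (Term.map (Equiv.refl I) t) - mono t)
  | map_trans {I J K : Type} [Finite I] [Finite J] [Finite K] (e : I ≃ J) (f : J ≃ K)
      (t : Term I) :
      IsNull (mono (Term.map (e.trans f) t) - mono (Term.map f (Term.map e t)))
  | comp_map {I J I' J' : Type} [Finite I] [Finite J] [Finite I'] [Finite J']
      (e : I ≃ I') (f : J ≃ J') (s : Term (Option I)) (t : Term J) :
      IsNull (mono (Term.comp (Term.map (Equiv.optionCongr e) s) (Term.map f t)) -
        mono (Term.map (Equiv.sumCongr e f) (Term.comp s t)))
  | comp_one {I : Type} [Finite I] (s : Term (Option I)) :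
      IsNull (mono (Term.comp s Term.one) - mono (Term.map (Equiv.optionEquivSumPUnit I) s))
  | one_comp {J : Type} [Finite J] (t : Term J) :
      IsNull (mono (Term.comp (Term.map unitStar Term.one) t) -
        mono (Term.map (Equiv.emptySum Empty J).symm t))
  | comp_assoc {I J K : Type} [Finite I] [Finite J] [Finite K]
      (s : Term (Option I)) (t : Term (Option J)) (r : Term K) :
      IsNull (mono (Term.comp (Term.map (starRight I J) (Term.comp s t)) r) -
        mono (Term.map (Equiv.sumAssoc I J K).symm (Term.comp s (Term.comp t r))))
  | comp_comm {I J K : Type} [Finite I] [Finite J] [Finite K]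
      (s : Term (Option (Option I))) (t : Term J) (r : Term K) :
      IsNull (mono (Term.comp (Term.map (starLeft I J) (Term.comp s t)) r) -
        ((-1 : ℂ) ^ (t.deg.1 * r.deg.1)) •
          mono (Term.map (exchange I J K) (Term.comp (Term.map (starLeft I K)
            (Term.comp (Term.map (swapStars I) s) r)) t)))

/-- The operadic ideal. -/
def nullSpace (I : Type) : Submodule ℂ (Poly I) where
  carrier := {a | IsNull a}
  zero_mem' := IsNull.zero
  add_mem' := IsNull.add
  smul_mem' c _ := IsNull.smul c

/-- The space `Ram(I)`. -/
abbrev RamObj (I : Type) : Type 1 := Poly I ⧸ nullSpace I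

theorem nullSpace_map {I J : Type} [Finite I] [Finite J] (e : I ≃ J) :
    nullSpace I ≤ (nullSpace J).comap (polyMap e) := fun _ h => IsNull.map e h

theorem polyMap_mono {I J : Type} [Finite I] [Finite J] (e : I ≃ J) (t : Term I) :
    polyMap e (mono t) = mono (Term.map e t) := by
  simp [polyMap, mono]

theorem polyComp_mono {I J : Type} [Finite I] [Finite J] (s : Term (Option I)) (t : Term J) :
    polyComp (mono s) (mono t) = mono (Term.comp s t) := by
  simp [polyComp, mono]

theorem poly_induction {I : Type} {p : Poly I → Prop} (a : Poly I) (zero : p 0)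
    (add : ∀ a b, p a → p b → p (a + b)) (smul : ∀ (c : ℂ) a, p a → p (c • a))
    (mono : ∀ t, p (mono t)) : p a := by
  induction a using Finsupp.induction_linear with
  | zero => exact zero
  | add a b ha hb => exact add a b ha hb
  | single t c => simpa [Ramanujan.mono] using smul c _ (mono t)

theorem polyComp_null_left {I J : Type} [Finite I] [Finite J] {a : Poly (Option I)}
    (ha : IsNull a) (b : Poly J) : IsNull (polyComp a b) := by
  induction b using poly_induction with
  | zero => simpa using IsNull.zero
  | add b c hb hc => rw [map_add]; exact hb.add hc
  | smul c b hb => rw [map_smul]; exact hb.smul c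
  | mono t => exact ha.comp_left t

theorem polyComp_null_right {I J : Type} [Finite I] [Finite J] (a : Poly (Option I))
    {b : Poly J} (hb : IsNull b) : IsNull (polyComp a b) := by
  induction a using poly_induction with
  | zero => simpa using IsNull.zero
  | add a c ha hc => rw [map_add, LinearMap.add_apply]; exact ha.add hc
  | smul c a ha => rw [map_smul, LinearMap.smul_apply]; exact ha.smul c
  | mono s => exact hb.comp_right s

/-- Relabelling on `Ram`. -/
noncomputable def ramMap {I J : Type} [Finite I] [Finite J] (e : I ≃ J) :
    RamObj I →ₗ[ℂ] RamObj J :=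
  (nullSpace I).mapQ (nullSpace J) (polyMap e) (nullSpace_map e)

/-- Composition on `Ram`. -/
noncomputable def ramComp {I J : Type} [Finite I] [Finite J] :
    RamObj (Option I) →ₗ[ℂ] RamObj J →ₗ[ℂ] RamObj (I ⊕ J) :=
  (nullSpace (Option I)).liftQ
    { toFun := fun a => (nullSpace J).mapQ (nullSpace (I ⊕ J)) (polyComp a)
        fun _ hb => polyComp_null_right a hb
      map_add' := fun a a' => by
        refine Submodule.linearMap_qext _ (LinearMap.ext fun b => ?_)
        change (nullSpace (I ⊕ J)).mkQ (polyComp (a + a') b) =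
          (nullSpace (I ⊕ J)).mkQ (polyComp a b) + (nullSpace (I ⊕ J)).mkQ (polyComp a' b)
        rw [map_add, LinearMap.add_apply, map_add]
      map_smul' := fun c a => by
        refine Submodule.linearMap_qext _ (LinearMap.ext fun b => ?_)
        change (nullSpace (I ⊕ J)).mkQ (polyComp (c • a) b) =
          c • (nullSpace (I ⊕ J)).mkQ (polyComp a b)
        rw [map_smul, LinearMap.smul_apply, map_smul] }
    (by
      intro a ha
      refine Submodule.linearMap_qext _ (LinearMap.ext fun b => ?_)
      exact (Submodule.Quotient.mk_eq_zero _).2 (polyComp_null_left ha b))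

/-- The class in `Ram(I)` of a monomial. -/
noncomputable def cls {I : Type} (t : Term I) : RamObj I := (nullSpace I).mkQ (mono t)

theorem ramMap_cls {I J : Type} [Finite I] [Finite J] (e : I ≃ J) (t : Term I) :
    ramMap e (cls t) = cls (Term.map e t) := by
  simp only [ramMap, cls, Submodule.mkQ_apply, Submodule.mapQ_apply, polyMap_mono]

theorem ramComp_cls {I J : Type} [Finite I] [Finite J] (s : Term (Option I)) (t : Term J) :
    ramComp (cls s) (cls t) = cls (Term.comp s t) := by
  change (nullSpace (I ⊕ J)).mkQ (polyComp (mono s) (mono t)) = _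
  rw [polyComp_mono, cls]

theorem cls_eq {I : Type} {s t : Term I} (h : IsNull (mono s - mono t)) : cls s = cls t := by
  rw [cls, cls, ← sub_eq_zero, ← map_sub]
  exact (Submodule.Quotient.mk_eq_zero _).2 h

theorem ram_induction {I : Type} {p : RamObj I → Prop} (x : RamObj I) (zero : p 0)
    (add : ∀ x y, p x → p y → p (x + y)) (smul : ∀ (c : ℂ) x, p x → p (c • x))
    (cls : ∀ t, p (cls t)) : p x := by
  obtain ⟨a, rfl⟩ := (nullSpace I).mkQ_surjective x
  induction a using poly_induction with
  | zero => simpa using zero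
  | add a b ha hb => rw [map_add]; exact add _ _ ha hb
  | smul c a ha => rw [map_smul]; exact smul c _ ha
  | mono t => exact cls t

/-- The component of bidegree `d` of `Ram(I)`, spanned by the monomials of bidegree `d`. -/
noncomputable def ramGr (I : Type) (d : ℤ × ℤ) : Submodule ℂ (RamObj I) :=
  Submodule.span ℂ {x | ∃ t : Term I, t.deg = d ∧ cls t = x}

/-- The homogeneous component of bidegree `d` of a linear combination. -/
noncomputable def polyPart {I : Type} (d : ℤ × ℤ) : Poly I →ₗ[ℂ] Poly I :=
  Finsupp.linearCombination ℂ fun t => if t.deg = d then mono t else 0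

theorem polyPart_mono {I : Type} (d : ℤ × ℤ) (t : Term I) :
    polyPart d (mono t) = if t.deg = d then mono t else 0 := by
  simp [polyPart, mono]

/-- A linear combination of monomials of the same bidegree. -/
def Homog {I : Type} (d : ℤ × ℤ) (a : Poly I) : Prop :=
  ∀ d', polyPart d' a = if d = d' then a else 0

theorem homog_mono {I : Type} (t : Term I) : Homog t.deg (mono t) := fun d => polyPart_mono d t

theorem Homog.add {I : Type} {d : ℤ × ℤ} {a b : Poly I} (ha : Homog d a) (hb : Homog d b) :
    Homog d (a + b) := by
  intro d'
  rw [map_add, ha, hb]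
  split_ifs <;> simp

theorem Homog.smul {I : Type} {d : ℤ × ℤ} (c : ℂ) {a : Poly I} (ha : Homog d a) :
    Homog d (c • a) := by
  intro d'
  rw [map_smul, ha]
  split_ifs <;> simp

theorem Homog.sub {I : Type} {d : ℤ × ℤ} {a b : Poly I} (ha : Homog d a) (hb : Homog d b) :
    Homog d (a - b) := by
  intro d'
  rw [map_sub, ha, hb]
  split_ifs <;> simp

theorem homog_of_deg {I : Type} {d : ℤ × ℤ} {t : Term I} (h : t.deg = d) : Homog d (mono t) :=
  h ▸ homog_mono t

theorem homog_quad (g h : Gen) (e : Unit ⊕ Fin 2 ≃ Fin 3) :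
    Homog (g.deg + h.deg) (quad g h e) := homog_mono _

theorem RamRel.homog {I : Type} {a : Poly I} (h : RamRel a) : ∃ d, Homog d a := by
  cases h with
  | symm_E => exact ⟨(0, 0), (homog_of_deg rfl).sub (homog_of_deg rfl)⟩
  | antisymm_L => exact ⟨(0, 1), (homog_of_deg rfl).add (homog_of_deg rfl)⟩
  | antisymm_Ω => exact ⟨(1, 1), (homog_of_deg rfl).add (homog_of_deg rfl)⟩
  | jacobi =>
    exact ⟨_, ((homog_quad .L .L _).add (homog_quad .L .L _)).add (homog_quad .L .L _)⟩
  | mixed =>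
    have h (e e') : Homog (1, 2) (quad .Ω .L e + quad .L .Ω e') :=
      (homog_of_deg rfl).add (homog_of_deg rfl)
    exact ⟨_, ((h _ _).add (h _ _)).add (h _ _)⟩
  | assoc => exact ⟨_, (homog_quad .E .E _).sub (homog_quad .E .E _)⟩
  | leibniz =>
    have h (e e' e'') : Homog (0, 1) (quad .L .E e - (quad .E .L e' + quad .E .L e'')) :=
      (homog_of_deg rfl).sub ((homog_of_deg rfl).add (homog_of_deg rfl))
    exact ⟨_, h _ _ _⟩
  | bessel =>
    have h (e e' e'') : Homog (1, 1) (quad .Ω .E e - (quad .E .Ω e' + quad .E .Ω e'')) :=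
      (homog_of_deg rfl).sub ((homog_of_deg rfl).add (homog_of_deg rfl))
    exact ⟨_, h _ _ _⟩

theorem Homog.isNull_part {I : Type} {d : ℤ × ℤ} {a : Poly I} (h : Homog d a) (ha : IsNull a)
    (d' : ℤ × ℤ) : IsNull (polyPart d' a) := by
  rw [h]
  split_ifs
  exacts [ha, .zero]

theorem isNull_part_sub {I : Type} {s t : Term I} (hd : t.deg = s.deg) {c : ℂ}
    (ha : IsNull (mono s - c • mono t)) (d : ℤ × ℤ) : IsNull (polyPart d (mono s - c • mono t)) :=
  ((homog_mono s).sub ((homog_of_deg hd).smul c)).isNull_part ha d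

theorem isNull_part_sub' {I : Type} {s t : Term I} (hd : t.deg = s.deg)
    (ha : IsNull (mono s - mono t)) (d : ℤ × ℤ) : IsNull (polyPart d (mono s - mono t)) :=
  ((homog_mono s).sub (homog_of_deg hd)).isNull_part ha d

theorem polyPart_map {I J : Type} [Finite I] [Finite J] (e : I ≃ J) (d : ℤ × ℤ) (a : Poly I) :
    polyPart d (polyMap e a) = polyMap e (polyPart d a) := by
  induction a using poly_induction with
  | zero => simp
  | add a b ha hb => simp only [map_add, ha, hb]
  | smul c a ha => simp only [map_smul, ha]
  | mono t =>
    rw [polyMap_mono, polyPart_mono, polyPart_mono, Term.deg]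
    split_ifs
    · rw [polyMap_mono]
    · rw [map_zero]

theorem polyPart_comp_left {I J : Type} [Finite I] [Finite J] (d : ℤ × ℤ)
    (a : Poly (Option I)) (t : Term J) :
    polyPart d (polyComp a (mono t)) = polyComp (polyPart (d - t.deg) a) (mono t) := by
  induction a using poly_induction with
  | zero => simp
  | add a b ha hb => simp only [map_add, LinearMap.add_apply, ha, hb]
  | smul c a ha => simp only [map_smul, LinearMap.smul_apply, ha]
  | mono s =>
    rw [polyComp_mono, polyPart_mono, polyPart_mono, Term.deg]
    simp only [eq_sub_iff_add_eq]
    split_ifs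
    · rw [polyComp_mono]
    · simp

theorem polyPart_comp_right {I J : Type} [Finite I] [Finite J] (d : ℤ × ℤ)
    (s : Term (Option I)) (b : Poly J) :
    polyPart d (polyComp (mono s) b) = polyComp (mono s) (polyPart (d - s.deg) b) := by
  induction b using poly_induction with
  | zero => simp
  | add a b ha hb => simp only [map_add, ha, hb]
  | smul c a ha => simp only [map_smul, ha]
  | mono t =>
    rw [polyComp_mono, polyPart_mono, polyPart_mono, Term.deg]
    simp only [eq_sub_iff_add_eq, add_comm t.deg]
    split_ifs
    · rw [polyComp_mono]
    · simp

/-- The operadic ideal is homogeneous. -/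
theorem IsNull.part {I : Type} {a : Poly I} (h : IsNull a) :
    ∀ d, IsNull (polyPart d a) := by
  induction h with
  | rel h => obtain ⟨d, hd⟩ := h.homog; exact hd.isNull_part (.rel h)
  | zero => intro d; simpa using IsNull.zero
  | add _ _ iha ihb => intro d; rw [map_add]; exact (iha d).add (ihb d)
  | smul c _ iha => intro d; rw [map_smul]; exact (iha d).smul c
  | map e _ ih => intro d; rw [polyPart_map]; exact (ih d).map e
  | comp_left t _ ih => intro d; rw [polyPart_comp_left]; exact (ih _).comp_left t
  | comp_right s _ ih => intro d; rw [polyPart_comp_right]; exact (ih _).comp_right s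
  | map_refl t => exact isNull_part_sub' (by simp only [Term.deg]) (.map_refl t)
  | map_trans e f t => exact isNull_part_sub' (by simp only [Term.deg]) (.map_trans e f t)
  | comp_map e f s t => exact isNull_part_sub' (by simp only [Term.deg]) (.comp_map e f s t)
  | comp_one s => exact isNull_part_sub' (by simp only [Term.deg, add_zero]) (.comp_one s)
  | one_comp t => exact isNull_part_sub' (by simp only [Term.deg, zero_add]) (.one_comp t)
  | comp_assoc s t r =>
    exact isNull_part_sub' (by simp only [Term.deg, add_assoc]) (.comp_assoc s t r)
  | comp_comm s t r =>
    exact isNull_part_sub (by simp only [Term.deg, add_right_comm]) (.comp_comm s t r)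

theorem cls_mem {I : Type} (t : Term I) : cls t ∈ ramGr I t.deg :=
  Submodule.subset_span ⟨t, rfl, rfl⟩

/-- The decomposition of linear combinations of monomials, with values in the components of
`Ram(I)`. -/
noncomputable def polyDecompose (I : Type) : Poly I →ₗ[ℂ] DirectSum (ℤ × ℤ) fun d => ramGr I d :=
  Finsupp.linearCombination ℂ fun t =>
    DirectSum.lof ℂ (ℤ × ℤ) (fun d => ramGr I d) t.deg ⟨cls t, cls_mem t⟩

theorem polyDecompose_mono {I : Type} (t : Term I) : polyDecompose I (mono t) =
    DirectSum.lof ℂ (ℤ × ℤ) (fun d => ramGr I d) t.deg ⟨cls t, cls_mem t⟩ := by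
  simp [polyDecompose, mono]

theorem polyDecompose_apply {I : Type} (a : Poly I) (d : ℤ × ℤ) :
    (polyDecompose I a d : RamObj I) = (nullSpace I).mkQ (polyPart d a) := by
  induction a using poly_induction with
  | zero => simp
  | add a b ha hb => simp only [map_add, DirectSum.add_apply, Submodule.coe_add, ha, hb]
  | smul c a ha => simp only [map_smul, DirectSum.smul_apply, Submodule.coe_smul, ha]
  | mono t =>
    rw [polyDecompose_mono, polyPart_mono]
    split_ifs with h
    · subst h
      rw [DirectSum.lof_apply]
      rfl
    · rw [DirectSum.lof_eq_of, DirectSum.of_eq_of_ne _ _ _ (Ne.symm h), map_zero]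
      rfl

theorem polyDecompose_null {I : Type} {a : Poly I} (ha : IsNull a) : polyDecompose I a = 0 := by
  refine DFinsupp.ext fun d => Subtype.ext ?_
  exact (polyDecompose_apply a d).trans
    ((Submodule.Quotient.mk_eq_zero (nullSpace I)).2 (IsNull.part ha d))

theorem polyDecompose_congr {I : Type} {a b : Poly I}
    (h : (nullSpace I).mkQ a = (nullSpace I).mkQ b) : polyDecompose I a = polyDecompose I b := by
  have h' : IsNull (a - b) := (Submodule.Quotient.eq (nullSpace I)).1 h
  have h'' := polyDecompose_null h'
  rw [← sub_add_cancel a b, map_add, h'', zero_add]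

theorem coe_polyDecompose {I : Type} (a : Poly I) :
    DirectSum.coeLinearMap (ramGr I) (polyDecompose I a) = (nullSpace I).mkQ a := by
  induction a using poly_induction with
  | zero => rw [map_zero, map_zero, map_zero]
  | add a b ha hb => rw [map_add, map_add, map_add, ha, hb]
  | smul c a ha => rw [map_smul, map_smul, map_smul, ha]
  | mono t =>
    rw [polyDecompose_mono, DirectSum.coeLinearMap_lof]
    rfl

theorem exists_polyDecompose {I : Type} (d : ℤ × ℤ) {x : RamObj I} (hx : x ∈ ramGr I d) :
    ∃ a, polyDecompose I a = DirectSum.lof ℂ (ℤ × ℤ) (fun d => ramGr I d) d ⟨x, hx⟩ := by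
  induction hx using Submodule.span_induction with
  | mem x h =>
    obtain ⟨t, rfl, rfl⟩ := h
    exact ⟨mono t, polyDecompose_mono t⟩
  | zero => exact ⟨0, (map_zero _).trans (map_zero _).symm⟩
  | add x y hx hy ihx ihy =>
    obtain ⟨a, ha⟩ := ihx
    obtain ⟨b, hb⟩ := ihy
    refine ⟨a + b, ?_⟩
    rw [map_add, ha, hb, ← map_add]
    rfl
  | smul c x hx ih =>
    obtain ⟨a, ha⟩ := ih
    refine ⟨c • a, ?_⟩
    rw [map_smul, ha, ← map_smul]
    rfl

theorem polyDecompose_surjective (I : Type) : Function.Surjective (polyDecompose I) := by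
  intro y
  induction y using DirectSum.induction_on with
  | zero => exact ⟨0, map_zero _⟩
  | of d x => exact exists_polyDecompose d x.2
  | add y z hy hz =>
    obtain ⟨a, rfl⟩ := hy
    obtain ⟨b, rfl⟩ := hz
    exact ⟨a + b, map_add _ _ _⟩

/-- `Ram(I)` is the direct sum of its components. -/
noncomputable instance ramDecomposition (I : Type) : DirectSum.Decomposition (ramGr I) where
  decompose' x := polyDecompose I (Function.surjInv (nullSpace I).mkQ_surjective x)
  left_inv x := (coe_polyDecompose _).trans (Function.surjInv_eq _ x)
  right_inv y := by
    obtain ⟨a, rfl⟩ := polyDecompose_surjective I y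
    exact polyDecompose_congr ((Function.surjInv_eq _ _).trans (coe_polyDecompose a))

theorem ramMap_mem {I J : Type} [Finite I] [Finite J] (e : I ≃ J) {d : ℤ × ℤ} {x : RamObj I}
    (hx : x ∈ ramGr I d) : ramMap e x ∈ ramGr J d := by
  induction hx using Submodule.span_induction with
  | mem x h =>
    obtain ⟨t, rfl, rfl⟩ := h
    rw [ramMap_cls]
    exact cls_mem (Term.map e t)
  | zero => rw [map_zero]; exact zero_mem _
  | add x y _ _ hx hy => rw [map_add]; exact add_mem hx hy
  | smul c x _ hx => rw [map_smul]; exact Submodule.smul_mem _ c hx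

theorem ramComp_mem {I J : Type} [Finite I] [Finite J] {d d' : ℤ × ℤ} {x : RamObj (Option I)}
    {y : RamObj J} (hx : x ∈ ramGr (Option I) d) (hy : y ∈ ramGr J d') :
    ramComp x y ∈ ramGr (I ⊕ J) (d + d') := by
  induction hx using Submodule.span_induction with
  | mem x h =>
    obtain ⟨s, rfl, rfl⟩ := h
    induction hy using Submodule.span_induction with
    | mem y h =>
      obtain ⟨t, rfl, rfl⟩ := h
      rw [ramComp_cls]
      exact cls_mem (Term.comp s t)
    | zero => rw [map_zero]; exact zero_mem _
    | add x y _ _ hx hy => rw [map_add]; exact add_mem hx hy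
    | smul c x _ hx => rw [map_smul]; exact Submodule.smul_mem _ c hx
  | zero => rw [map_zero]; exact zero_mem _
  | add x y _ _ hx hy => rw [map_add]; exact add_mem hx hy
  | smul c x _ hx => rw [map_smul]; exact Submodule.smul_mem _ c hx

theorem ramComp_comm {I J K : Type} [Finite I] [Finite J] [Finite K] {d d' : ℤ × ℤ}
    (x : RamObj (Option (Option I))) {y : RamObj J} {z : RamObj K} (hy : y ∈ ramGr J d)
    (hz : z ∈ ramGr K d') :
    ramComp (ramMap (starLeft I J) (ramComp x y)) z =
      ((-1 : ℂ) ^ (d.1 * d'.1)) • ramMap (exchange I J K)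
        (ramComp (ramMap (starLeft I K) (ramComp (ramMap (swapStars I) x) z)) y) := by
  induction x using ram_induction with
  | zero => simp
  | add x y hx hy => simp only [map_add, LinearMap.add_apply, hx, hy, smul_add]
  | smul c x hx => simp only [map_smul, LinearMap.smul_apply, hx, smul_comm c]
  | cls s =>
    induction hy using Submodule.span_induction with
    | zero => simp
    | add x y _ _ hx hy => simp only [map_add, LinearMap.add_apply, hx, hy, smul_add]
    | smul c x _ hx => simp only [map_smul, LinearMap.smul_apply, hx, smul_comm c]
    | mem y h =>
      obtain ⟨t, rfl, rfl⟩ := h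
      induction hz using Submodule.span_induction with
      | zero => simp
      | add x y _ _ hx hy => simp only [map_add, LinearMap.add_apply, hx, hy, smul_add]
      | smul c x _ hx => simp only [map_smul, LinearMap.smul_apply, hx, smul_comm c]
      | mem z h =>
        obtain ⟨r, rfl, rfl⟩ := h
        simp only [ramComp_cls, ramMap_cls]
        have h := (Submodule.Quotient.mk_eq_zero (nullSpace _)).2 (IsNull.comp_comm s t r)
        rw [← Submodule.mkQ_apply, map_sub, map_smul, sub_eq_zero] at h
        exact h

theorem ramComp_assoc {I J K : Type} [Finite I] [Finite J] [Finite K]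
    (x : RamObj (Option I)) (y : RamObj (Option J)) (z : RamObj K) :
    ramComp (ramMap (starRight I J) (ramComp x y)) z =
      ramMap (Equiv.sumAssoc I J K).symm (ramComp x (ramComp y z)) := by
  induction x using ram_induction with
  | zero => simp
  | add x y hx hy => simp only [map_add, LinearMap.add_apply, hx, hy]
  | smul c x hx => simp only [map_smul, LinearMap.smul_apply, hx]
  | cls s =>
    induction y using ram_induction with
    | zero => simp
    | add x y hx hy => simp only [map_add, LinearMap.add_apply, hx, hy]
    | smul c x hx => simp only [map_smul, LinearMap.smul_apply, hx]
    | cls t =>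
      induction z using ram_induction with
      | zero => simp
      | add x y hx hy => simp only [map_add, hx, hy]
      | smul c x hx => simp only [map_smul, hx]
      | cls r =>
        simp only [ramComp_cls, ramMap_cls]
        exact cls_eq (.comp_assoc s t r)

theorem ramComp_map {I J I' J' : Type} [Finite I] [Finite J] [Finite I'] [Finite J']
    (e : I ≃ I') (f : J ≃ J') (x : RamObj (Option I)) (y : RamObj J) :
    ramComp (ramMap (Equiv.optionCongr e) x) (ramMap f y) =
      ramMap (Equiv.sumCongr e f) (ramComp x y) := by
  induction x using ram_induction with
  | zero => simp
  | add x y hx hy => simp only [map_add, LinearMap.add_apply, hx, hy]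
  | smul c x hx => simp only [map_smul, LinearMap.smul_apply, hx]
  | cls s =>
    induction y using ram_induction with
    | zero => simp
    | add x y hx hy => simp only [map_add, hx, hy]
    | smul c x hx => simp only [map_smul, hx]
    | cls t =>
      simp only [ramComp_cls, ramMap_cls]
      exact cls_eq (.comp_map e f s t)

theorem ramMap_refl {I : Type} [Finite I] (x : RamObj I) : ramMap (Equiv.refl I) x = x := by
  induction x using ram_induction with
  | zero => simp
  | add x y hx hy => rw [map_add, hx, hy]
  | smul c x hx => rw [map_smul, hx]
  | cls t => rw [ramMap_cls]; exact cls_eq (.map_refl t)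

theorem ramMap_trans {I J K : Type} [Finite I] [Finite J] [Finite K] (e : I ≃ J) (f : J ≃ K)
    (x : RamObj I) : ramMap (e.trans f) x = ramMap f (ramMap e x) := by
  induction x using ram_induction with
  | zero => simp
  | add x y hx hy => simp only [map_add, hx, hy]
  | smul c x hx => simp only [map_smul, hx]
  | cls t => simp only [ramMap_cls]; exact cls_eq (.map_trans e f t)

theorem ramComp_one {I : Type} [Finite I] (x : RamObj (Option I)) :
    ramComp x (cls Term.one) = ramMap (Equiv.optionEquivSumPUnit I) x := by
  induction x using ram_induction with
  | zero => simp
  | add x y hx hy => simp only [map_add, LinearMap.add_apply, hx, hy]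
  | smul c x hx => simp only [map_smul, LinearMap.smul_apply, hx]
  | cls t => simp only [ramMap_cls, ramComp_cls]; exact cls_eq (.comp_one t)

theorem ramOne_comp {J : Type} [Finite J] (y : RamObj J) :
    ramComp (ramMap unitStar (cls Term.one)) y = ramMap (Equiv.emptySum Empty J).symm y := by
  induction y using ram_induction with
  | zero => simp
  | add x y hx hy => simp only [map_add, hx, hy]
  | smul c x hx => simp only [map_smul, hx]
  | cls t => simp only [ramMap_cls, ramComp_cls]; exact cls_eq (.one_comp t)

/-- The operad `Ram`, generated by `E` symmetric of degree `(0, 0)`, `L` antisymmetric of degree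
`(0, 1)` and `Ω` antisymmetric of degree `(1, 1)`, subject to the relations `RamRel`. -/
noncomputable def Ram : BigradedOperad.{1} where
  obj I _ := RamObj I
  gr I _ := ramGr I
  map := ramMap
  one := cls Term.one
  comp := ramComp
  map_mem := ramMap_mem
  one_mem := cls_mem Term.one
  comp_mem := ramComp_mem
  map_refl := ramMap_refl
  map_trans := ramMap_trans
  comp_map := ramComp_map
  comp_one := ramComp_one
  one_comp := ramOne_comp
  comp_assoc := ramComp_assoc
  comp_comm := ramComp_comm

/-- The generators `E`, `L`, `Ω` as elements of `Ram({0, 1})`. -/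
noncomputable def Ram.gen (g : Gen) : Ram.obj (Fin 2) := cls (Term.gen g)

/-- A derivation of degree `(1, 0)` with `E ↦ 0`, `L ↦ Ω`, `Ω ↦ 0`. -/
def Ram.ExtendsD' (D' : Ram.EndoFamily) : Prop :=
  Ram.IsDerivation (1, 0) D' ∧
    D' (Fin 2) (Ram.gen .E) = 0 ∧
    D' (Fin 2) (Ram.gen .L) = Ram.gen .Ω ∧
    D' (Fin 2) (Ram.gen .Ω) = 0

/-- A derivation of degree `(-1, 0)` with `E ↦ 0`, `Ω ↦ L`, `L ↦ 0`. -/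
def Ram.ExtendsD (D : Ram.EndoFamily) : Prop :=
  Ram.IsDerivation (-1, 0) D ∧
    D (Fin 2) (Ram.gen .E) = 0 ∧
    D (Fin 2) (Ram.gen .Ω) = Ram.gen .L ∧
    D (Fin 2) (Ram.gen .L) = 0

/-- A Hopf operad structure on `Ram` whose coproduct `Δ` satisfies `Δ E = E ⊗ E`,
`Δ L = E ⊗ L + L ⊗ E` and `Δ Ω = E ⊗ Ω + Ω ⊗ E`. -/
def Ram.ExtendsΔ (C : Ram.CoalgebraFamily) : Prop :=
  Ram.IsHopf C ∧
    (C (Fin 2)).comul (Ram.gen .E) = Ram.gen .E ⊗ₜ[ℂ] Ram.gen .E ∧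
    (C (Fin 2)).comul (Ram.gen .L) =
      Ram.gen .E ⊗ₜ[ℂ] Ram.gen .L + Ram.gen .L ⊗ₜ[ℂ] Ram.gen .E ∧
    (C (Fin 2)).comul (Ram.gen .Ω) =
      Ram.gen .E ⊗ₜ[ℂ] Ram.gen .Ω + Ram.gen .Ω ⊗ₜ[ℂ] Ram.gen .E

end Ramanujan

/-! Everything is deduced from the universal property of `Ram`: values of the three generators in
an operad that satisfy the defining relations extend to a morphism from `Ram` (`Ram.isHom_lift`),
and a morphism is determined by these values (`Ram.hom_ext`). The target is given as a `CompSystem`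
with `CompSystem.IsOperad`, where the components of the various bidegrees are only required to span;
this makes tensor products cheap to construct.

* A derivation `D` of odd first degree is a morphism `x ↦ x + ε D x` to a square-zero extension of
  `Ram` (`CompSystem.squareZero`). The relations hold there because `D'` takes the Jacobi relation
  to the mixed one and the Leibniz relation for `L` to that for `Ω`, while `D` takes the mixed
  relation to twice the Jacobi relation and the Leibniz relation for `Ω` to that for `L`; `D'` kills
  the mixed relation because the two terms `Ω ∘ Ω` come with opposite signs. The unit is idempotent,
  so derivations vanish on it, and they are determined by their values on the generators.
* The coproduct is a morphism to the tensor square (`CompSystem.tensor`), where the relations hold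
  by `CompSystem.SatisfiesRel.tensor`: with `a i = E_{i,⋆} ∘ L_{j,k}` for cyclic `(i, j, k)`, the
  Leibniz relation reads `L_{i,⋆} ∘ E_{j,k} = a (i + 2) - a (i + 1)`, so that the cross terms in the
  coproduct of the Jacobi relation cancel in the cyclic sum; the mixed relation is similar. The
  counit is a morphism to the commutative operad. Coassociativity and counitality are equalities of
  morphisms from `Ram`, hence may be checked on the generators.
* `D ⊗ 1 + 1 ⊗ D` is a derivation of the tensor square (`BigradedOperad.tensorEndo_leibniz`), so the
  coderivation property propagates from the generators to all composites; the same holds for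
  `D ∘ D = 0`, by the odd sign in the Leibniz rule, and for the vanishing of the counit on the image
  of `D`. -/

universe v w x

namespace Ramanujan

/-! ### Systems with relabelling and composition -/

/-- The data of an operad in bigraded vector spaces, without the axioms, and with the direct sum
decomposition weakened to a family of components that span. Unlike `BigradedOperad`, this notion is
stable under tensor products without any work on decompositions. -/
structure CompSystem where
  /-- The vector space attached to a finite set. -/
  obj : (I : Type) → [Finite I] → Type v
  [addCommGroup : ∀ (I : Type) [Finite I], AddCommGroup (obj I)]
  [module : ∀ (I : Type) [Finite I], Module ℂ (obj I)]
  /-- The component of each bidegree. -/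
  gr : ∀ (I : Type) [Finite I], ℤ × ℤ → Submodule ℂ (obj I)
  /-- The projection onto the components of odd first degree. -/
  odd : ∀ (I : Type) [Finite I], obj I →ₗ[ℂ] obj I
  /-- The action of bijections. -/
  map : ∀ {I J : Type} [Finite I] [Finite J], (I ≃ J) → (obj I →ₗ[ℂ] obj J)
  /-- The unit. -/
  one : obj Unit
  /-- The composition map `∘_⋆`. -/
  comp : ∀ {I J : Type} [Finite I] [Finite J],
    obj (Option I) →ₗ[ℂ] obj J →ₗ[ℂ] obj (I ⊕ J)
  iSup_gr : ∀ (I : Type) [Finite I], ⨆ d, gr I d = ⊤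
  odd_of_mem : ∀ {I : Type} [Finite I] {d : ℤ × ℤ} {x : obj I},
    x ∈ gr I d → odd I x = if Odd d.1 then x else 0
  map_mem : ∀ {I J : Type} [Finite I] [Finite J] (e : I ≃ J) {d : ℤ × ℤ} {x : obj I},
    x ∈ gr I d → map e x ∈ gr J d
  one_mem : one ∈ gr Unit 0
  comp_mem : ∀ {I J : Type} [Finite I] [Finite J] {d d' : ℤ × ℤ} {x : obj (Option I)}
    {y : obj J}, x ∈ gr (Option I) d → y ∈ gr J d' → comp x y ∈ gr (I ⊕ J) (d + d')

attribute [instance] CompSystem.addCommGroup CompSystem.module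

namespace CompSystem

/-- The axioms of an operad, for a system `Q`. -/
structure IsOperad (Q : CompSystem.{v}) : Prop where
  map_refl : ∀ {I : Type} [Finite I] (x : Q.obj I), Q.map (Equiv.refl I) x = x
  map_trans : ∀ {I J K : Type} [Finite I] [Finite J] [Finite K] (e : I ≃ J) (f : J ≃ K)
    (x : Q.obj I), Q.map (e.trans f) x = Q.map f (Q.map e x)
  comp_map : ∀ {I J I' J' : Type} [Finite I] [Finite J] [Finite I'] [Finite J']
    (e : I ≃ I') (f : J ≃ J') (x : Q.obj (Option I)) (y : Q.obj J),
    Q.comp (Q.map (Equiv.optionCongr e) x) (Q.map f y) = Q.map (Equiv.sumCongr e f) (Q.comp x y)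
  comp_one : ∀ {I : Type} [Finite I] (x : Q.obj (Option I)),
    Q.comp x Q.one = Q.map (Equiv.optionEquivSumPUnit I) x
  one_comp : ∀ {J : Type} [Finite J] (y : Q.obj J),
    Q.comp (Q.map unitStar Q.one) y = Q.map (Equiv.emptySum Empty J).symm y
  comp_assoc : ∀ {I J K : Type} [Finite I] [Finite J] [Finite K]
    (x : Q.obj (Option I)) (y : Q.obj (Option J)) (z : Q.obj K),
    Q.comp (Q.map (starRight I J) (Q.comp x y)) z =
      Q.map (Equiv.sumAssoc I J K).symm (Q.comp x (Q.comp y z))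
  comp_comm : ∀ {I J K : Type} [Finite I] [Finite J] [Finite K] {d d' : ℤ × ℤ}
    (x : Q.obj (Option (Option I))) {y : Q.obj J} {z : Q.obj K}, y ∈ Q.gr J d → z ∈ Q.gr K d' →
    Q.comp (Q.map (starLeft I J) (Q.comp x y)) z =
      ((-1 : ℂ) ^ (d.1 * d'.1)) •
        Q.map (exchange I J K)
          (Q.comp (Q.map (starLeft I K) (Q.comp (Q.map (swapStars I) x) z)) y)

/-- An additive property that holds for homogeneous elements holds everywhere. -/
theorem homog_induction (Q : CompSystem.{v}) {I : Type} [Finite I] {p : Q.obj I → Prop}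
    (x : Q.obj I) (add : ∀ x y, p x → p y → p (x + y))
    (homog : ∀ d, ∀ x ∈ Q.gr I d, p x) : p x := by
  have hx : x ∈ ⨆ d, Q.gr I d := Q.iSup_gr I ▸ Submodule.mem_top
  induction hx using Submodule.iSup_induction' with
  | mem d x hx => exact homog d x hx
  | zero => exact homog 0 0 (zero_mem _)
  | add x y _ _ hx hy => exact add x y hx hy

/-- Morphisms of systems: families of linear maps that preserve the bidegrees and commute with
relabelling, unit and composition. -/
structure IsHom (P : CompSystem.{v}) (Q : CompSystem.{w})
    (f : ∀ (I : Type) [Finite I], P.obj I →ₗ[ℂ] Q.obj I) : Prop where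
  mem : ∀ {I : Type} [Finite I] {d : ℤ × ℤ} {x : P.obj I}, x ∈ P.gr I d → f I x ∈ Q.gr I d
  map : ∀ {I J : Type} [Finite I] [Finite J] (e : I ≃ J) (x : P.obj I),
    f J (P.map e x) = Q.map e (f I x)
  one : f Unit P.one = Q.one
  comp : ∀ {I J : Type} [Finite I] [Finite J] (x : P.obj (Option I)) (y : P.obj J),
    f (I ⊕ J) (P.comp x y) = Q.comp (f (Option I) x) (f J y)

theorem IsHom.trans {P : CompSystem.{u}} {Q : CompSystem.{v}} {R : CompSystem.{w}}
    {f : ∀ (I : Type) [Finite I], P.obj I →ₗ[ℂ] Q.obj I}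
    {g : ∀ (I : Type) [Finite I], Q.obj I →ₗ[ℂ] R.obj I} (hf : P.IsHom Q f) (hg : Q.IsHom R g) :
    P.IsHom R fun I _ => g I ∘ₗ f I where
  mem hx := hg.mem (hf.mem hx)
  map e x := by simp only [LinearMap.comp_apply, hf.map, hg.map]
  one := by simp only [LinearMap.comp_apply, hf.one, hg.one]
  comp x y := by simp only [LinearMap.comp_apply, hf.comp, hg.comp]

/-! ### The universal property of `Ram` -/

section Lift

variable (Q : CompSystem.{v})

/-- `Q.quad e a b` is the element `a_{i,⋆} ∘_⋆ b_{j,k}`, where `e` is `tri i j k`. -/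
noncomputable def quad (e : Unit ⊕ Fin 2 ≃ Fin 3) :
    Q.obj (Fin 2) →ₗ[ℂ] Q.obj (Fin 2) →ₗ[ℂ] Q.obj (Fin 3) :=
  (Q.comp.compr₂ (Q.map e)) ∘ₗ Q.map pairStar

theorem quad_apply (e : Unit ⊕ Fin 2 ≃ Fin 3) (a b : Q.obj (Fin 2)) :
    Q.quad e a b = Q.map e (Q.comp (Q.map pairStar a) b) := rfl

/-- The values `φ` of the generators have the right bidegrees and satisfy the relations of
`Ram`. -/
structure SatisfiesRel (φ : Gen → Q.obj (Fin 2)) : Prop where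
  mem : ∀ g, φ g ∈ Q.gr (Fin 2) g.deg
  symm_E : Q.map (Equiv.swap 0 1) (φ .E) = φ .E
  antisymm_L : Q.map (Equiv.swap 0 1) (φ .L) = -φ .L
  antisymm_Ω : Q.map (Equiv.swap 0 1) (φ .Ω) = -φ .Ω
  jacobi : Q.quad (tri 0 1 2) (φ .L) (φ .L) + Q.quad (tri 1 2 0) (φ .L) (φ .L) +
    Q.quad (tri 2 0 1) (φ .L) (φ .L) = 0
  mixed : (Q.quad (tri 0 1 2) (φ .Ω) (φ .L) + Q.quad (tri 0 1 2) (φ .L) (φ .Ω)) +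
    (Q.quad (tri 1 2 0) (φ .Ω) (φ .L) + Q.quad (tri 1 2 0) (φ .L) (φ .Ω)) +
    (Q.quad (tri 2 0 1) (φ .Ω) (φ .L) + Q.quad (tri 2 0 1) (φ .L) (φ .Ω)) = 0
  assoc : Q.quad (tri 0 1 2) (φ .E) (φ .E) = Q.quad (tri 1 2 0) (φ .E) (φ .E)
  leibniz : Q.quad (tri 0 1 2) (φ .L) (φ .E) =
    Q.quad (tri 1 0 2) (φ .E) (φ .L) + Q.quad (tri 2 0 1) (φ .E) (φ .L)
  bessel : Q.quad (tri 0 1 2) (φ .Ω) (φ .E) =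
    Q.quad (tri 1 0 2) (φ .E) (φ .Ω) + Q.quad (tri 2 0 1) (φ .E) (φ .Ω)

variable {Q} (φ : Gen → Q.obj (Fin 2))

/-- The value of a monomial when the generators take the values `φ`. -/
noncomputable def eval : {I : Type} → [Finite I] → Term I → Q.obj I
  | _, _, .gen g => φ g
  | _, _, .one => Q.one
  | _, _, @Term.map _ _ _ _ e t => Q.map e (eval t)
  | _, _, @Term.comp _ _ _ _ s t => Q.comp (eval s) (eval t)

theorem eval_mem (hφ : Q.SatisfiesRel φ) {I : Type} (t : Term I) :
    ∀ [Finite I], eval φ t ∈ Q.gr I t.deg := by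
  induction t with
  | gen g => exact hφ.mem g
  | one => exact Q.one_mem
  | map e t ih => exact Q.map_mem e ih
  | comp s t ihs iht => exact Q.comp_mem ihs iht

/-- The linear extension of `eval` to linear combinations of monomials. -/
noncomputable def polyEval (I : Type) [Finite I] : Poly I →ₗ[ℂ] Q.obj I :=
  Finsupp.linearCombination ℂ (eval φ)

@[simp]
theorem polyEval_mono {I : Type} [Finite I] (t : Term I) :
    polyEval φ I (mono t) = eval φ t := by
  simp [polyEval, mono]

theorem polyEval_polyMap {I J : Type} [Finite I] [Finite J] (e : I ≃ J) (a : Poly I) :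
    polyEval φ J (polyMap e a) = Q.map e (polyEval φ I a) := by
  induction a using poly_induction with
  | zero => simp
  | add a b ha hb => simp only [map_add, ha, hb]
  | smul c a ha => simp only [map_smul, ha]
  | mono t => rw [polyMap_mono, polyEval_mono, polyEval_mono, eval]

theorem polyEval_polyComp {I J : Type} [Finite I] [Finite J] (a : Poly (Option I)) (b : Poly J) :
    polyEval φ (I ⊕ J) (polyComp a b) =
      Q.comp (polyEval φ (Option I) a) (polyEval φ J b) := by
  induction a using poly_induction with
  | zero => simp
  | add a b ha hb => simp only [map_add, LinearMap.add_apply, ha, hb]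
  | smul c a ha => simp only [map_smul, LinearMap.smul_apply, ha]
  | mono s =>
    induction b using poly_induction with
    | zero => simp
    | add a b ha hb => simp only [map_add, ha, hb]
    | smul c a ha => simp only [map_smul, ha]
    | mono t => rw [polyComp_mono, polyEval_mono, polyEval_mono, polyEval_mono, eval]

theorem polyEval_quad (g h : Gen) (e : Unit ⊕ Fin 2 ≃ Fin 3) :
    polyEval φ (Fin 3) (Ramanujan.quad g h e) = Q.quad e (φ g) (φ h) := by
  rw [Ramanujan.quad, polyEval_mono]
  rfl

theorem polyEval_rel (hφ : Q.SatisfiesRel φ) {I : Type} [Finite I] {a : Poly I}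
    (ha : RamRel a) : polyEval φ I a = 0 := by
  cases ha with
  | symm_E => simpa only [map_sub, polyEval_mono, sub_eq_zero, eval] using hφ.symm_E
  | antisymm_L =>
    simpa only [map_add, polyEval_mono, add_eq_zero_iff_eq_neg, eval] using hφ.antisymm_L
  | antisymm_Ω =>
    simpa only [map_add, polyEval_mono, add_eq_zero_iff_eq_neg, eval] using hφ.antisymm_Ω
  | jacobi => simpa only [map_add, polyEval_quad] using hφ.jacobi
  | mixed => simpa only [map_add, polyEval_quad] using hφ.mixed
  | assoc => simpa only [map_sub, polyEval_quad, sub_eq_zero] using hφ.assoc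
  | leibniz => simpa only [map_sub, map_add, polyEval_quad, sub_eq_zero] using hφ.leibniz
  | bessel => simpa only [map_sub, map_add, polyEval_quad, sub_eq_zero] using hφ.bessel

/-- The operadic ideal is in the kernel of the evaluation in an operad. -/
theorem polyEval_null (hQ : Q.IsOperad) (hφ : Q.SatisfiesRel φ) {I : Type} {a : Poly I}
    (ha : IsNull a) : ∀ [Finite I], polyEval φ I a = 0 := by
  induction ha with
  | rel h => intro; exact polyEval_rel φ hφ h
  | zero => intro; exact map_zero _
  | add _ _ iha ihb => intro; rw [map_add, iha, ihb, add_zero]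
  | smul c _ iha => intro; rw [map_smul, iha, smul_zero]
  | map e _ ih => intro; rw [polyEval_polyMap, ih, map_zero]
  | comp_left t _ ih => intro; rw [polyEval_polyComp, ih, map_zero, LinearMap.zero_apply]
  | comp_right s _ ih => intro; rw [polyEval_polyComp, ih, map_zero]
  | map_refl t => intro; simp only [map_sub, polyEval_mono, eval, hQ.map_refl, sub_self]
  | map_trans e f t => intro; simp only [map_sub, polyEval_mono, eval, hQ.map_trans, sub_self]
  | comp_map e f s t => intro; simp only [map_sub, polyEval_mono, eval, hQ.comp_map, sub_self]
  | comp_one s => intro; simp only [map_sub, polyEval_mono, eval, hQ.comp_one, sub_self]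
  | one_comp t => intro; simp only [map_sub, polyEval_mono, eval, hQ.one_comp, sub_self]
  | comp_assoc s t r => intro; simp only [map_sub, polyEval_mono, eval, hQ.comp_assoc, sub_self]
  | comp_comm s t r =>
    intro
    simp only [map_sub, map_smul, polyEval_mono, eval]
    rw [hQ.comp_comm _ (eval_mem φ hφ t) (eval_mem φ hφ r), sub_self]

end Lift

end CompSystem

/-- The system underlying an operad. -/
noncomputable abbrev BigradedOperad.toCompSystem (P : BigradedOperad.{u}) : CompSystem.{u} where
  obj I _ := P.obj I
  gr I _ := P.gr I
  odd I _ := P.oddPart I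
  map := P.map
  one := P.one
  comp := P.comp
  iSup_gr I _ := (DirectSum.Decomposition.isInternal (P.gr I)).submodule_iSup_eq_top
  odd_of_mem := P.oddPart_of_mem
  map_mem := P.map_mem
  one_mem := P.one_mem
  comp_mem := P.comp_mem

theorem BigradedOperad.isOperad_toCompSystem (P : BigradedOperad.{u}) :
    P.toCompSystem.IsOperad where
  map_refl := P.map_refl
  map_trans := P.map_trans
  comp_map := P.comp_map
  comp_one := P.comp_one
  one_comp := P.one_comp
  comp_assoc := P.comp_assoc
  comp_comm := P.comp_comm

/-- `Ram`, as a system. -/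
noncomputable abbrev Ram.sys : CompSystem.{1} := Ram.toCompSystem

namespace Ram

/-- The morphism from `Ram` to an operad in which the values `φ` of the generators satisfy the
relations. -/
noncomputable def lift {Q : CompSystem.{v}} {φ : Gen → Q.obj (Fin 2)} (hQ : Q.IsOperad)
    (hφ : Q.SatisfiesRel φ) (I : Type) [Finite I] : Ram.obj I →ₗ[ℂ] Q.obj I :=
  (nullSpace I).liftQ (CompSystem.polyEval φ I) fun _ ha => CompSystem.polyEval_null φ hQ hφ ha

theorem lift_cls {Q : CompSystem.{v}} {φ : Gen → Q.obj (Fin 2)} (hQ : Q.IsOperad)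
    (hφ : Q.SatisfiesRel φ) {I : Type} [Finite I] (t : Term I) :
    lift hQ hφ I (cls t) = CompSystem.eval φ t :=
  CompSystem.polyEval_mono φ t

theorem lift_gen {Q : CompSystem.{v}} {φ : Gen → Q.obj (Fin 2)} (hQ : Q.IsOperad)
    (hφ : Q.SatisfiesRel φ) (g : Gen) : lift hQ hφ (Fin 2) (Ram.gen g) = φ g :=
  lift_cls hQ hφ _

/-- A property of the elements of `Ram` holds if it is linear, holds for the generators and the
unit, and is stable under relabelling and composition of homogeneous elements. -/
theorem induction {p : ∀ (I : Type) [Finite I], Ram.obj I → Prop}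
    (zero : ∀ (I : Type) [Finite I], p I 0)
    (add : ∀ (I : Type) [Finite I] (x y : Ram.obj I), p I x → p I y → p I (x + y))
    (smul : ∀ (I : Type) [Finite I] (c : ℂ) (x : Ram.obj I), p I x → p I (c • x))
    (gen : ∀ g, p (Fin 2) (Ram.gen g))
    (one : p Unit Ram.one)
    (map : ∀ (I J : Type) [Finite I] [Finite J] (e : I ≃ J) (x : Ram.obj I), p I x →
      p J (Ram.map e x))
    (comp : ∀ (I J : Type) [Finite I] [Finite J] (d d' : ℤ × ℤ) (x : Ram.obj (Option I))
      (y : Ram.obj J), x ∈ Ram.gr (Option I) d → y ∈ Ram.gr J d' → p (Option I) x → p J y →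
      p (I ⊕ J) (Ram.comp x y))
    {I : Type} [Finite I] (x : Ram.obj I) : p I x := by
  -- Finiteness is quantified in the conclusion because the index of a subterm varies.
  have key {I : Type} (t : Term I) : ∀ [Finite I], p I (cls t) := by
    induction t with
    | gen g => exact gen g
    | one => exact one
    | map e t ih =>
      intro
      have := map _ _ e (cls t) ih
      rwa [show Ram.map e (cls t) = cls (Term.map e t) from ramMap_cls e t] at this
    | comp s t ihs iht =>
      intro
      have := comp _ _ _ _ (cls s) (cls t) (cls_mem s) (cls_mem t) ihs iht
      rwa [show Ram.comp (cls s) (cls t) = cls (Term.comp s t) from ramComp_cls s t] at this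
  induction x using ram_induction with
  | zero => exact zero I
  | add x y hx hy => exact add I x y hx hy
  | smul c x hx => exact smul I c x hx
  | cls t => exact key t

/-- Existence in the universal property of `Ram`. -/
theorem isHom_lift {Q : CompSystem.{v}} {φ : Gen → Q.obj (Fin 2)} (hQ : Q.IsOperad)
    (hφ : Q.SatisfiesRel φ) : Ram.sys.IsHom Q (lift hQ hφ) where
  mem := by
    intro I _ d x hx
    induction hx using Submodule.span_induction with
    | mem x h =>
      obtain ⟨t, rfl, rfl⟩ := h
      rw [lift_cls]
      exact CompSystem.eval_mem φ hφ t
    | zero => exact (map_zero (lift hQ hφ I)).symm ▸ zero_mem _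
    | add x y _ _ hx hy => exact (map_add (lift hQ hφ I) x y).symm ▸ add_mem hx hy
    | smul c x _ hx => exact (map_smul (lift hQ hφ I) c x).symm ▸ Submodule.smul_mem _ c hx
  map := by
    intro I J _ _ e x
    obtain ⟨a, rfl⟩ := (nullSpace I).mkQ_surjective x
    exact CompSystem.polyEval_polyMap φ e a
  one := lift_cls hQ hφ _
  comp := by
    intro I J _ _ x y
    obtain ⟨a, rfl⟩ := (nullSpace (Option I)).mkQ_surjective x
    obtain ⟨b, rfl⟩ := (nullSpace J).mkQ_surjective y
    exact CompSystem.polyEval_polyComp φ a b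

/-- Uniqueness in the universal property of `Ram`. -/
theorem hom_ext {Q : CompSystem.{v}} {f g : ∀ (I : Type) [Finite I], Ram.obj I →ₗ[ℂ] Q.obj I}
    (hf : Ram.sys.IsHom Q f) (hg : Ram.sys.IsHom Q g)
    (h : ∀ a, f (Fin 2) (Ram.gen a) = g (Fin 2) (Ram.gen a)) {I : Type} [Finite I]
    (x : Ram.obj I) : f I x = g I x := by
  induction x using Ram.induction with
  | zero => simp only [map_zero]
  | add _ x y hx hy => simp only [map_add, hx, hy]
  | smul _ c x hx => simp only [map_smul, hx]
  | gen a => exact h a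
  | one => exact hf.one.trans hg.one.symm
  | map _ _ e x hx => exact (hf.map e x).trans ((congrArg _ hx).trans (hg.map e x).symm)
  | comp _ _ d d' x y _ _ hx hy =>
    refine (hf.comp x y).trans (Eq.trans ?_ (hg.comp x y).symm)
    rw [hx, hy]

/-- The generators satisfy the relations of `Ram`. -/
theorem satisfiesRel_gen : Ram.sys.SatisfiesRel Ram.gen := by
  have hc {g h : Gen} {e : Unit ⊕ Fin 2 ≃ Fin 3} : Ram.sys.quad e (Ram.gen g) (Ram.gen h) =
      (nullSpace _).mkQ (Ramanujan.quad g h e) := by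
    change ramMap e (ramComp (ramMap pairStar (cls _)) (cls _)) = _
    rw [ramMap_cls, ramComp_cls, ramMap_cls]
    rfl
  have hs {g : Gen} : Ram.sys.map (Equiv.swap 0 1) (Ram.gen g) =
      cls (Term.map (Equiv.swap 0 1) (Term.gen g)) := ramMap_cls _ _
  have h0 {I : Type} {a : Poly I} (h : RamRel a) : (nullSpace I).mkQ a = 0 :=
    (Submodule.Quotient.mk_eq_zero _).2 (.rel h)
  constructor
  · exact fun g => cls_mem (Term.gen g)
  · exact hs.trans (sub_eq_zero.1 ((map_sub _ _ _).symm.trans (h0 .symm_E)))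
  · exact hs.trans (eq_neg_of_add_eq_zero_left ((map_add _ _ _).symm.trans (h0 .antisymm_L)))
  · exact hs.trans (eq_neg_of_add_eq_zero_left ((map_add _ _ _).symm.trans (h0 .antisymm_Ω)))
  · have := h0 .jacobi
    simp only [map_add, ← hc] at this
    exact this
  · have := h0 .mixed
    simp only [map_add, ← hc] at this
    exact this
  · have := h0 .assoc
    simp only [map_sub, ← hc] at this
    exact sub_eq_zero.1 this
  · have := h0 .leibniz
    simp only [map_sub, map_add, ← hc] at this
    exact sub_eq_zero.1 this
  · have := h0 .bessel
    simp only [map_sub, map_add, ← hc] at this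
    exact sub_eq_zero.1 this

end Ram

/-! ### Tensor products of systems -/

/-- Two powers of `-1` agree when their exponents have the same parity. -/
theorem neg_one_zpow_congr {a b : ℤ} (c : ℤ) (h : a = b + 2 * c) :
    (-1 : ℂ) ^ a = (-1 : ℂ) ^ b := by
  rw [h, zpow_add₀ (by norm_num), zpow_mul]
  simp

theorem neg_one_zpow_mul (a b : ℤ) : (-1 : ℂ) ^ a * (-1 : ℂ) ^ b = (-1 : ℂ) ^ (a + b) :=
  (zpow_add₀ (by norm_num) a b).symm

namespace CompSystem

variable (A : CompSystem.{v}) (B : CompSystem.{w})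

/-- The component of bidegree `d` of `A(I) ⊗ B(I)`. -/
noncomputable def tensorGr (I : Type) [Finite I] (d : ℤ × ℤ) :
    Submodule ℂ (A.obj I ⊗[ℂ] B.obj I) :=
  ⨆ (a : ℤ × ℤ) (b : ℤ × ℤ) (_ : a + b = d),
    LinearMap.range (TensorProduct.mapIncl (A.gr I a) (B.gr I b))

variable {A B} in
theorem tmul_mem {I : Type} [Finite I] {a b d : ℤ × ℤ} {x : A.obj I} {y : B.obj I}
    (hx : x ∈ A.gr I a) (hy : y ∈ B.gr I b) (h : a + b = d) : x ⊗ₜ[ℂ] y ∈ tensorGr A B I d := by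
  refine Submodule.mem_iSup_of_mem a (Submodule.mem_iSup_of_mem b
    (Submodule.mem_iSup_of_mem h ⟨⟨x, hx⟩ ⊗ₜ ⟨y, hy⟩, rfl⟩))

variable {A B} in
/-- Homogeneous elements of a tensor product are sums of tensors of homogeneous elements. -/
theorem tensorGr_induction {I : Type} [Finite I] {d : ℤ × ℤ}
    {p : (t : A.obj I ⊗[ℂ] B.obj I) → t ∈ tensorGr A B I d → Prop}
    {t : A.obj I ⊗[ℂ] B.obj I} (ht : t ∈ tensorGr A B I d)
    (add : ∀ s t hs ht, p s hs → p t ht → p (s + t) (add_mem hs ht))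
    (tmul : ∀ a b (h : a + b = d) x (hx : x ∈ A.gr I a) y (hy : y ∈ B.gr I b),
      p (x ⊗ₜ y) (tmul_mem hx hy h)) : p t ht := by
  have zero : ∃ h, p 0 h := by
    have := tmul d 0 (add_zero d) 0 (zero_mem _) 0 (zero_mem _)
    simp only [TensorProduct.zero_tmul] at this
    exact ⟨_, this⟩
  have add' (s t) : (∃ hs, p s hs) → (∃ ht, p t ht) → ∃ h, p (s + t) h :=
    fun ⟨hs, h⟩ ⟨ht, h'⟩ => ⟨_, add s t hs ht h h'⟩
  suffices ∃ ht, p t ht from this.2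
  refine Submodule.iSup_induction (motive := fun t => ∃ ht, p t ht) _ ht (fun a t ht => ?_)
    zero add'
  refine Submodule.iSup_induction (motive := fun t => ∃ ht, p t ht) _ ht (fun b t ht => ?_)
    zero add'
  refine Submodule.iSup_induction (motive := fun t => ∃ ht, p t ht) _ ht (fun h t ht => ?_)
    zero add'
  obtain ⟨t, rfl⟩ := ht
  induction t using TensorProduct.induction_on with
  | zero => rwa [map_zero]
  | tmul x y => exact ⟨_, tmul a b h x x.2 y y.2⟩
  | add s t hs ht => rw [map_add]; exact add' _ _ hs ht

variable {A B} in
/-- An additive property of the elements of a tensor product need only be checked on tensors of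
homogeneous elements. -/
theorem tensor_induction {I : Type} [Finite I]
    {p : A.obj I ⊗[ℂ] B.obj I → Prop} (t : A.obj I ⊗[ℂ] B.obj I)
    (add : ∀ s t, p s → p t → p (s + t))
    (tmul : ∀ a b, ∀ x ∈ A.gr I a, ∀ y ∈ B.gr I b, p (x ⊗ₜ y)) : p t := by
  induction t using TensorProduct.induction_on with
  | zero => simpa using tmul 0 0 0 (zero_mem _) 0 (zero_mem _)
  | tmul x y =>
    induction x using A.homog_induction with
    | add x x' hx hx' => rw [TensorProduct.add_tmul]; exact add _ _ hx hx'
    | homog a x hx =>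
      induction y using B.homog_induction with
      | add y y' hy hy' => rw [TensorProduct.tmul_add]; exact add _ _ hy hy'
      | homog b y hy => exact tmul a b x hx y hy
  | add s t hs ht => exact add _ _ hs ht

/-- The composition map of a tensor product, `(x ⊗ y) ∘_⋆ (x' ⊗ y') =
(-1) ^ (|y| |x'|) (x ∘_⋆ x') ⊗ (y ∘_⋆ y')`. The sign is encoded by the projections onto the odd
parts: it is `1 - 2 = -1` when `y` and `x'` are both odd, and `1 - 0 = 1` otherwise. -/
noncomputable def tensorComp (I J : Type) [Finite I] [Finite J] :
    A.obj (Option I) ⊗[ℂ] B.obj (Option I) →ₗ[ℂ] A.obj J ⊗[ℂ] B.obj J →ₗ[ℂ]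
      A.obj (I ⊕ J) ⊗[ℂ] B.obj (I ⊕ J) :=
  TensorProduct.map₂ A.comp B.comp -
    (2 : ℂ) • TensorProduct.map₂ (A.comp.compl₂ (A.odd J)) (B.comp ∘ₗ B.odd (Option I))

theorem tensorComp_of_mem {I J : Type} [Finite I] [Finite J] {d d' : ℤ × ℤ}
    (x : A.obj (Option I)) {y : B.obj (Option I)} {x' : A.obj J} (y' : B.obj J)
    (hy : y ∈ B.gr (Option I) d) (hx' : x' ∈ A.gr J d') :
    tensorComp A B I J (x ⊗ₜ y) (x' ⊗ₜ y') =
      ((-1 : ℂ) ^ (d.1 * d'.1)) • (A.comp x x' ⊗ₜ[ℂ] B.comp y y') := by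
  simp only [tensorComp, LinearMap.sub_apply, LinearMap.smul_apply, TensorProduct.map₂_apply_tmul,
    TensorProduct.map_tmul, LinearMap.compl₂_apply, LinearMap.comp_apply, B.odd_of_mem hy,
    A.odd_of_mem hx']
  by_cases h : Odd d.1
  · by_cases h' : Odd d'.1
    · rw [if_pos h, if_pos h', (h.mul h').neg_one_zpow]; module
    · rw [if_neg h', ((Int.not_odd_iff_even.1 h').mul_left _).neg_one_zpow]; simp
  · rw [if_neg h, ((Int.not_odd_iff_even.1 h).mul_right _).neg_one_zpow]; simp

/-- The tensor product of two systems, with the Koszul sign in the composition. -/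
noncomputable abbrev tensor : CompSystem.{max v w} where
  obj I _ := A.obj I ⊗[ℂ] B.obj I
  gr I _ := tensorGr A B I
  odd I _ := TensorProduct.map (A.odd I) LinearMap.id + TensorProduct.map LinearMap.id (B.odd I) -
    (2 : ℂ) • TensorProduct.map (A.odd I) (B.odd I)
  map e := TensorProduct.map (A.map e) (B.map e)
  one := A.one ⊗ₜ B.one
  comp := tensorComp A B _ _
  iSup_gr I _ := by
    refine eq_top_iff.2 fun t _ => ?_
    induction t using tensor_induction with
    | add s t hs ht => exact add_mem (hs trivial) (ht trivial)
    | tmul a b x hx y hy => exact Submodule.mem_iSup_of_mem (a + b) (tmul_mem hx hy rfl)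
  odd_of_mem := by
    intro I _ d t ht
    induction ht using tensorGr_induction with
    | add s t _ _ hs ht => rw [map_add, hs, ht]; split_ifs <;> simp
    | tmul a b h x hx y hy =>
      subst h
      simp only [LinearMap.sub_apply, LinearMap.add_apply, LinearMap.smul_apply,
        TensorProduct.map_tmul, LinearMap.id_apply, A.odd_of_mem hx, B.odd_of_mem hy,
        Prod.fst_add, Int.odd_add, ← Int.not_odd_iff_even]
      by_cases ha : Odd a.1 <;> by_cases hb : Odd b.1 <;> simp [ha, hb]
      module
  map_mem := by
    intro I J _ _ e d t ht
    induction ht using tensorGr_induction with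
    | add s t _ _ hs ht => rw [map_add]; exact add_mem hs ht
    | tmul a b h x hx y hy => exact tmul_mem (A.map_mem e hx) (B.map_mem e hy) h
  one_mem := tmul_mem A.one_mem B.one_mem (add_zero _)
  comp_mem := by
    intro I J _ _ d d' s t hs ht
    induction hs using tensorGr_induction with
    | add s s' _ _ hs hs' => rw [map_add, LinearMap.add_apply]; exact add_mem hs hs'
    | tmul a b h x hx y hy =>
      induction ht using tensorGr_induction with
      | add t t' _ _ ht ht' => rw [map_add]; exact add_mem ht ht'
      | tmul a' b' h' x' hx' y' hy' =>
        rw [tensorComp_of_mem A B x y' hy hx']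
        refine Submodule.smul_mem _ _ (tmul_mem (A.comp_mem hx hx') (B.comp_mem hy hy') ?_)
        rw [← h, ← h']
        abel

/-- The Koszul sign in the composition of a tensor product is what the axioms of an operad require.
The signs on the two sides of the sequential axiom are the same; in the parallel axiom the exponents
differ by an even number. -/
theorem isOperad_tensor {A : CompSystem.{v}} {B : CompSystem.{w}} (hA : A.IsOperad)
    (hB : B.IsOperad) : (A.tensor B).IsOperad where
  map_refl t := by
    induction t using tensor_induction with
    | add s t hs ht => rw [map_add, hs, ht]
    | tmul a b x hx y hy => rw [TensorProduct.map_tmul, hA.map_refl, hB.map_refl]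
  map_trans e f t := by
    induction t using tensor_induction with
    | add s t hs ht => simp only [map_add, hs, ht]
    | tmul a b x hx y hy => simp only [TensorProduct.map_tmul, hA.map_trans, hB.map_trans]
  comp_map e f s t := by
    induction s using tensor_induction with
    | add s s' hs hs' => simp only [map_add, LinearMap.add_apply, hs, hs']
    | tmul a b x hx y hy =>
      induction t using tensor_induction with
      | add t t' ht ht' => simp only [map_add, ht, ht']
      | tmul a' b' x' hx' y' hy' =>
        simp only [TensorProduct.map_tmul]
        rw [tensorComp_of_mem A B _ _ (B.map_mem _ hy) (A.map_mem _ hx'),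
          tensorComp_of_mem A B _ _ hy hx', map_smul, TensorProduct.map_tmul, hA.comp_map,
          hB.comp_map]
  comp_one s := by
    induction s using tensor_induction with
    | add s s' hs hs' => simp only [map_add, LinearMap.add_apply, hs, hs']
    | tmul a b x hx y hy =>
      rw [tensorComp_of_mem A B _ _ hy A.one_mem, TensorProduct.map_tmul, hA.comp_one,
        hB.comp_one]
      simp
  one_comp t := by
    induction t using tensor_induction with
    | add s s' hs hs' => simp only [map_add, hs, hs']
    | tmul a b x hx y hy =>
      rw [TensorProduct.map_tmul, tensorComp_of_mem A B _ _ (B.map_mem _ B.one_mem) hx,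
        TensorProduct.map_tmul, hA.one_comp, hB.one_comp]
      simp
  comp_assoc s t r := by
    induction s using tensor_induction with
    | add s s' hs hs' => simp only [map_add, LinearMap.add_apply, hs, hs']
    | tmul a b x hx x' hx' =>
      induction t using tensor_induction with
      | add t t' ht ht' => simp only [map_add, LinearMap.add_apply, ht, ht']
      | tmul c d y hy y' hy' =>
        induction r using tensor_induction with
        | add t t' ht ht' => simp only [map_add, ht, ht']
        | tmul e f z hz z' hz' =>
          rw [tensorComp_of_mem A B _ _ hx' hy, tensorComp_of_mem A B _ _ hy' hz]
          simp only [map_smul, LinearMap.smul_apply, TensorProduct.map_tmul]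
          rw [tensorComp_of_mem A B _ _ (B.map_mem _ (B.comp_mem hx' hy')) hz,
            tensorComp_of_mem A B _ _ hx' (A.comp_mem hy hz)]
          simp only [map_smul, TensorProduct.map_tmul, smul_smul, hA.comp_assoc, hB.comp_assoc,
            neg_one_zpow_mul]
          congr 1
          apply neg_one_zpow_congr 0
          simp only [Prod.fst_add]
          ring
  comp_comm := by
    intro I J K _ _ _ d d' s t r ht hr
    induction s using tensor_induction with
    | add s s' hs hs' => simp only [map_add, LinearMap.add_apply, smul_add, hs, hs']
    | tmul p q x hx x' hx' =>
      induction ht using tensorGr_induction with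
      | add t t' _ _ ht ht' => simp only [map_add, LinearMap.add_apply, smul_add, ht, ht']
      | tmul a b h y hy y' hy' =>
        subst h
        induction hr using tensorGr_induction with
        | add t t' _ _ ht ht' => simp only [map_add, LinearMap.add_apply, smul_add, ht, ht']
        | tmul a' b' h z hz z' hz' =>
          subst h
          simp only [TensorProduct.map_tmul]
          rw [tensorComp_of_mem A B _ _ hx' hy, tensorComp_of_mem A B _ _ (B.map_mem _ hx') hz]
          simp only [map_smul, LinearMap.smul_apply, TensorProduct.map_tmul]
          rw [tensorComp_of_mem A B _ _ (B.map_mem _ (B.comp_mem hx' hy')) hz,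
            tensorComp_of_mem A B _ _
              (B.map_mem _ (B.comp_mem (B.map_mem (swapStars I) hx') hz')) hy,
            hA.comp_comm _ hy hz, hB.comp_comm _ hy' hz']
          simp only [map_smul, TensorProduct.map_tmul, smul_smul, TensorProduct.tmul_smul,
            ← TensorProduct.smul_tmul', neg_one_zpow_mul]
          congr 1
          apply neg_one_zpow_congr (-(a.1 * b'.1))
          simp only [Prod.fst_add]
          ring

/-! ### Morphisms between tensor products -/

theorem IsHom.tensor {A : CompSystem.{u}} {A' : CompSystem.{v}} {B : CompSystem.{w}}
    {B' : CompSystem.{x}}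
    {f : ∀ (I : Type) [Finite I], A.obj I →ₗ[ℂ] A'.obj I}
    {g : ∀ (I : Type) [Finite I], B.obj I →ₗ[ℂ] B'.obj I} (hf : A.IsHom A' f)
    (hg : B.IsHom B' g) :
    (A.tensor B).IsHom (A'.tensor B') fun I _ => TensorProduct.map (f I) (g I) where
  mem ht := by
    induction ht using tensorGr_induction with
    | add s t _ _ hs ht => rw [map_add]; exact add_mem hs ht
    | tmul a b h x hx y hy => exact tmul_mem (hf.mem hx) (hg.mem hy) h
  map e t := by
    induction t using tensor_induction with
    | add s t hs ht => simp only [map_add, hs, ht]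
    | tmul a b x hx y hy => simp only [TensorProduct.map_tmul, hf.map, hg.map]
  one := by rw [TensorProduct.map_tmul, hf.one, hg.one]
  comp s t := by
    induction s using tensor_induction with
    | add s s' hs hs' => simp only [map_add, LinearMap.add_apply, hs, hs']
    | tmul a b x hx y hy =>
      induction t using tensor_induction with
      | add t t' ht ht' => simp only [map_add, ht, ht']
      | tmul a' b' x' hx' y' hy' =>
        simp only [TensorProduct.map_tmul]
        rw [tensorComp_of_mem A B _ _ hy hx', tensorComp_of_mem A' B' _ _ (hg.mem hy) (hf.mem hx'),
          map_smul, TensorProduct.map_tmul, hf.comp, hg.comp]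

theorem isHom_id (A : CompSystem.{v}) : A.IsHom A fun _ _ => LinearMap.id where
  mem hx := hx
  map _ _ := rfl
  one := rfl
  comp _ _ := rfl

/-- An additive property of the elements of a triple tensor product need only be checked on tensors
of homogeneous elements. -/
theorem tensor_tensor_induction {A : CompSystem.{u}} {B : CompSystem.{v}} {C : CompSystem.{w}}
    {I : Type} [Finite I] {p : (A.obj I ⊗[ℂ] B.obj I) ⊗[ℂ] C.obj I → Prop}
    (t : (A.obj I ⊗[ℂ] B.obj I) ⊗[ℂ] C.obj I)
    (add : ∀ s t, p s → p t → p (s + t))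
    (tmul : ∀ a b c, ∀ x ∈ A.gr I a, ∀ y ∈ B.gr I b, ∀ z ∈ C.gr I c, p (x ⊗ₜ y ⊗ₜ z)) : p t := by
  induction t using tensor_induction (A := A.tensor B) (B := C) with
  | add s t hs ht => exact add s t hs ht
  | tmul _ c s hs z hz =>
    clear hs
    induction s using tensor_induction with
    | add s t hs ht => rw [TensorProduct.add_tmul]; exact add _ _ hs ht
    | tmul a b x hx y hy => exact tmul a b c x hx y hy z hz

/-- The associators are morphisms: both ways of composing triple tensors carry the sign
`(-1) ^ (|y| |x'| + |z| |x'| + |z| |y'|)`. -/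
theorem isHom_assoc (A : CompSystem.{u}) (B : CompSystem.{v}) (C : CompSystem.{w}) :
    ((A.tensor B).tensor C).IsHom (A.tensor (B.tensor C)) fun I _ =>
      (TensorProduct.assoc ℂ (A.obj I) (B.obj I) (C.obj I)).toLinearMap where
  mem ht := by
    induction ht using tensorGr_induction with
    | add s t _ _ hs ht => rw [map_add]; exact add_mem hs ht
    | tmul a b h x hx y hy =>
      induction hx using tensorGr_induction with
      | add s t _ _ hs ht => rw [TensorProduct.add_tmul, map_add]; exact add_mem hs ht
      | tmul c d h' x hx z hz =>
        exact tmul_mem hx (tmul_mem hz hy rfl) (by rw [← h, ← h', add_assoc])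
  map e t := by
    induction t using tensor_tensor_induction with
    | add s t hs ht => simp only [map_add, hs, ht]
    | tmul a b c x hx y hy z hz => rfl
  one := rfl
  comp s t := by
    induction s using tensor_tensor_induction with
    | add s s' hs hs' => simp only [map_add, LinearMap.add_apply, hs, hs']
    | tmul a b c x hx y hy z hz =>
      induction t using tensor_tensor_induction with
      | add t t' ht ht' => simp only [map_add, ht, ht']
      | tmul a' b' c' x' hx' y' hy' z' hz' =>
        simp only [LinearEquiv.coe_coe, TensorProduct.assoc_tmul]
        rw [tensorComp_of_mem (A.tensor B) C _ _ hz (tmul_mem hx' hy' rfl),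
          tensorComp_of_mem A (B.tensor C) _ _ (tmul_mem hy hz rfl) hx']
        simp only
        rw [tensorComp_of_mem A B _ _ hy hx', tensorComp_of_mem B C _ _ hz hy']
        simp only [map_smul, TensorProduct.tmul_smul, ← TensorProduct.smul_tmul', smul_smul,
          TensorProduct.assoc_tmul, neg_one_zpow_mul]
        congr 1
        apply neg_one_zpow_congr 0
        simp only [Prod.fst_add]
        ring

/-! ### The commutative operad -/

/-- The commutative operad, as a system: every space is `ℂ`, in bidegree `(0, 0)`. -/
noncomputable abbrev com : CompSystem.{0} where
  obj _ _ := ℂ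
  gr _ _ d := if d = 0 then ⊤ else ⊥
  odd _ _ := 0
  map _ := LinearMap.id
  one := 1
  comp := LinearMap.mul ℂ ℂ
  iSup_gr _ _ := eq_top_iff.2 fun x _ => Submodule.mem_iSup_of_mem 0 (by simp)
  odd_of_mem := by
    intro I _ d x hx
    by_cases h : d = 0
    · subst h; simp
    · rw [if_neg h, Submodule.mem_bot] at hx
      simp [hx]
  map_mem _ _ _ h := h
  one_mem := by simp
  comp_mem := by
    intro I J _ _ d d' x y hx hy
    by_cases h : d = 0
    · by_cases h' : d' = 0
      · simp [h, h']
      · rw [if_neg h', Submodule.mem_bot] at hy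
        simp [hy]
    · rw [if_neg h, Submodule.mem_bot] at hx
      simp [hx]

theorem isOperad_com : com.IsOperad where
  map_refl _ := rfl
  map_trans _ _ _ := rfl
  comp_map _ _ _ _ := rfl
  comp_one x := mul_one x
  one_comp x := one_mul x
  comp_assoc x y z := mul_assoc x y z
  comp_comm := by
    intro I J K _ _ _ d d' x y z hy hz
    by_cases h : d = 0
    · subst h; simp [mul_right_comm]
    · replace hy : y ∈ (if d = 0 then ⊤ else ⊥ : Submodule ℂ ℂ) := hy
      rw [if_neg h, Submodule.mem_bot] at hy
      simp [hy]

/-- No sign appears in `1 ⊗ x`, as `1` has degree `0`. -/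
theorem isHom_one_tmul (A : CompSystem.{v}) :
    A.IsHom (com.tensor A) fun I _ => TensorProduct.mk ℂ ℂ (A.obj I) 1 where
  mem hx := tmul_mem (A := com) com.one_mem hx (zero_add _)
  map _ _ := rfl
  one := rfl
  comp {I J} _ _ x y := by
    induction x using A.homog_induction with
    | add x x' hx hx' => simp only [map_add, LinearMap.add_apply, hx, hx']
    | homog d x hx =>
      refine Eq.trans ?_ (tensorComp_of_mem com A (I := I) (J := J) 1 y hx com.one_mem).symm
      simp

theorem isHom_tmul_one (A : CompSystem.{v}) :
    A.IsHom (A.tensor com) fun I _ => (TensorProduct.mk ℂ (A.obj I) ℂ).flip 1 where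
  mem hx := tmul_mem (B := com) hx com.one_mem (add_zero _)
  map _ _ := rfl
  one := rfl
  comp {I J} _ _ x y := by
    induction y using A.homog_induction with
    | add x x' hx hx' => simp only [map_add, hx, hx']
    | homog d y hy =>
      refine Eq.trans ?_ (tensorComp_of_mem A com (I := I) (J := J) x 1 com.one_mem hy).symm
      simp

end CompSystem

/-! ### Derivations as morphisms to a square-zero extension -/

namespace CompSystem

variable (A : CompSystem.{v})

/-- The parity involution `x ↦ (-1) ^ |x| x`. -/
noncomputable def par (I : Type) [Finite I] : A.obj I →ₗ[ℂ] A.obj I :=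
  LinearMap.id - (2 : ℂ) • A.odd I

variable {A} in
theorem par_of_mem {I : Type} [Finite I] {d : ℤ × ℤ} {x : A.obj I} (hx : x ∈ A.gr I d) :
    A.par I x = ((-1 : ℂ) ^ d.1) • x := by
  rw [par, LinearMap.sub_apply, LinearMap.smul_apply, A.odd_of_mem hx, LinearMap.id_apply]
  rcases Int.even_or_odd d.1 with h | h
  · rw [if_neg (by simpa using h), h.neg_one_zpow]; module
  · rw [if_pos h, h.neg_one_zpow]; module

theorem par_map {I J : Type} [Finite I] [Finite J] (e : I ≃ J) (x : A.obj I) :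
    A.par J (A.map e x) = A.map e (A.par I x) := by
  induction x using A.homog_induction with
  | add x y hx hy => simp only [map_add, hx, hy]
  | homog d x hx => rw [par_of_mem hx, par_of_mem (A.map_mem e hx), map_smul]

theorem par_comp {I J : Type} [Finite I] [Finite J] (x : A.obj (Option I)) (y : A.obj J) :
    A.par (I ⊕ J) (A.comp x y) = A.comp (A.par _ x) (A.par _ y) := by
  induction x using A.homog_induction with
  | add x x' hx hx' => simp only [map_add, LinearMap.add_apply, hx, hx']
  | homog d x hx =>
    induction y using A.homog_induction with
    | add y y' hy hy' => simp only [map_add, hy, hy']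
    | homog d' y hy =>
      rw [par_of_mem hx, par_of_mem hy, par_of_mem (A.comp_mem hx hy)]
      simp only [map_smul, LinearMap.smul_apply, smul_smul, neg_one_zpow_mul, Prod.fst_add,
        add_comm]

/-- The square-zero extension of `A` by a copy of itself with degrees shifted by `δ`, of odd first
degree: the pairs `(x, x')`, to be read as `x + ε x'`, with
`(x, x') ∘_⋆ (y, y') = (x ∘_⋆ y, x' ∘_⋆ y + (-1) ^ |x| x ∘_⋆ y')`. A map `x ↦ (x, D x)` is a
morphism exactly when `D` is a derivation of bidegree `δ`. -/
noncomputable abbrev squareZero (δ : ℤ × ℤ) (hδ : Odd δ.1) : CompSystem.{v} where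
  obj I _ := A.obj I × A.obj I
  gr I _ d := (A.gr I d).prod (A.gr I (d + δ))
  odd I _ := (A.odd I).prodMap (LinearMap.id - A.odd I)
  map e := (A.map e).prodMap (A.map e)
  one := (A.one, 0)
  comp := LinearMap.mk₂ ℂ
    (fun p q => (A.comp p.1 q.1, A.comp p.2 q.1 + A.comp (A.par _ p.1) q.2))
    (fun p p' q => Prod.ext (by simp) (by simp; abel))
    (fun c p q => Prod.ext (by simp) (by simp))
    (fun p q q' => Prod.ext (by simp) (by simp; abel))
    (fun c p q => Prod.ext (by simp) (by simp))
  iSup_gr I _ := by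
    refine eq_top_iff.2 fun p _ => ?_
    have h₁ (x : A.obj I) : (x, (0 : A.obj I)) ∈ ⨆ d, (A.gr I d).prod (A.gr I (d + δ)) := by
      induction x using A.homog_induction with
      | add x y hx hy => simpa using add_mem hx hy
      | homog d x hx => exact Submodule.mem_iSup_of_mem d ⟨hx, zero_mem _⟩
    have h₂ (x : A.obj I) : ((0 : A.obj I), x) ∈ ⨆ d, (A.gr I d).prod (A.gr I (d + δ)) := by
      induction x using A.homog_induction with
      | add x y hx hy => simpa using add_mem hx hy
      | homog d x hx =>
        exact Submodule.mem_iSup_of_mem (d - δ) ⟨zero_mem _, by simpa using hx⟩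
    simpa using add_mem (h₁ p.1) (h₂ p.2)
  odd_of_mem := by
    intro I _ d p hp
    refine Prod.ext ((A.odd_of_mem hp.1).trans ?_) ?_
    · split_ifs <;> rfl
    · simp only [LinearMap.prodMap_apply, LinearMap.sub_apply, LinearMap.id_apply,
        A.odd_of_mem hp.2, Prod.fst_add, Int.odd_add, ← Int.not_odd_iff_even]
      by_cases h : Odd d.1 <;> simp [h, hδ]
  map_mem e _ _ hp := ⟨A.map_mem e hp.1, A.map_mem e hp.2⟩
  one_mem := ⟨A.one_mem, zero_mem _⟩
  comp_mem := by
    intro I J _ _ d d' p q hp hq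
    refine ⟨A.comp_mem hp.1 hq.1, add_mem ?_ ?_⟩
    · simpa only [add_right_comm] using A.comp_mem hp.2 hq.1
    · rw [par_of_mem hp.1, map_smul, LinearMap.smul_apply]
      refine Submodule.smul_mem _ _ ?_
      simpa only [add_assoc] using A.comp_mem hp.1 hq.2

theorem isOperad_squareZero {A : CompSystem.{v}} (hA : A.IsOperad) (δ : ℤ × ℤ) (hδ : Odd δ.1) :
    (A.squareZero δ hδ).IsOperad where
  map_refl p := Prod.ext (hA.map_refl p.1) (hA.map_refl p.2)
  map_trans e f p := Prod.ext (hA.map_trans e f p.1) (hA.map_trans e f p.2)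
  comp_map e f p q := by
    refine Prod.ext (hA.comp_map e f p.1 q.1) ?_
    simp [hA.comp_map, par_map]
  comp_one p := by
    refine Prod.ext (hA.comp_one p.1) ?_
    simp [hA.comp_one]
  one_comp q := by
    refine Prod.ext (hA.one_comp q.1) ?_
    simp [hA.one_comp, par_map, par_of_mem A.one_mem]
  comp_assoc p q r := by
    refine Prod.ext (hA.comp_assoc p.1 q.1 r.1) ?_
    simp only [LinearMap.mk₂_apply, LinearMap.prodMap_apply, map_add, LinearMap.add_apply,
      hA.comp_assoc, par_map, par_comp, add_assoc]
  comp_comm := by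
    intro I J K _ _ _ d d' p q r hq hr
    refine Prod.ext (hA.comp_comm p.1 hq.1 hr.1) ?_
    obtain ⟨k, hk⟩ := hδ
    simp only [LinearMap.mk₂_apply, LinearMap.prodMap_apply, map_add, LinearMap.add_apply,
      par_map, par_comp, Prod.smul_snd, smul_add]
    rw [par_of_mem hq.1, par_of_mem hr.1]
    simp only [map_smul, LinearMap.smul_apply]
    rw [hA.comp_comm _ hq.1 hr.1, hA.comp_comm _ hq.2 hr.1, hA.comp_comm _ hq.1 hr.2]
    simp only [smul_smul, neg_one_zpow_mul, Prod.fst_add, hk]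
    rw [add_right_comm, neg_one_zpow_congr (a := (d.1 + (2 * k + 1)) * d'.1) (k * d'.1)
      (b := d.1 * d'.1 + d'.1) (by ring), neg_one_zpow_congr
      (a := d.1 + d.1 * (d'.1 + (2 * k + 1))) (b := d.1 * d'.1) (d.1 + k * d.1) (by ring)]

theorem isHom_fst (A : CompSystem.{v}) (δ : ℤ × ℤ) (hδ : Odd δ.1) :
    (A.squareZero δ hδ).IsHom A fun I _ => LinearMap.fst ℂ (A.obj I) (A.obj I) where
  mem hp := hp.1
  map _ _ := rfl
  one := rfl
  comp _ _ := rfl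

theorem quad_squareZero (δ : ℤ × ℤ) (hδ : Odd δ.1) (e : Unit ⊕ Fin 2 ≃ Fin 3)
    (p q : A.obj (Fin 2) × A.obj (Fin 2)) : (A.squareZero δ hδ).quad e p q =
      (A.quad e p.1 q.1, A.quad e p.2 q.1 + A.quad e (A.par _ p.1) q.2) := by
  refine Prod.ext rfl ?_
  change A.map e (A.comp (A.map pairStar p.2) q.1 + A.comp (A.par _ (A.map pairStar p.1)) q.2) = _
  rw [par_map, map_add]
  rfl

end CompSystem

namespace Ram

open CompSystem

/-- A derivation of odd first degree exists as soon as the images `θ` of the generators are such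
that the pairs `(g, θ g)` satisfy the relations in the square-zero extension. -/
theorem exists_isDerivation (δ : ℤ × ℤ) (hδ : Odd δ.1) (θ : Gen → Ram.obj (Fin 2))
    (h : (Ram.sys.squareZero δ hδ).SatisfiesRel fun g => (Ram.gen g, θ g)) :
    ∃ D : Ram.EndoFamily, Ram.IsDerivation δ D ∧ ∀ g, D (Fin 2) (Ram.gen g) = θ g := by
  have hQ := isOperad_squareZero Ram.isOperad_toCompSystem δ hδ
  have hF := isHom_lift hQ h
  -- The first component of the morphism is the identity.
  have hfst {I : Type} [Finite I] (x : Ram.obj I) : (lift hQ h I x).1 = x :=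
    hom_ext (hF.trans (isHom_fst _ δ hδ)) (isHom_id _)
      (fun a => congrArg Prod.fst (lift_gen hQ h a)) x
  refine ⟨fun I _ => LinearMap.snd ℂ _ _ ∘ₗ lift hQ h I, ⟨?_, ?_, ?_⟩, fun g => ?_⟩
  · exact fun hx => (hF.mem hx).2
  · exact fun e x => congrArg Prod.snd (hF.map e x)
  · intro I J _ _ d x y hx
    refine (congrArg Prod.snd (hF.comp x y)).trans ?_
    obtain ⟨k, hk⟩ := id hδ
    have hs : (-1 : ℂ) ^ (δ.1 * d.1) = (-1) ^ d.1 :=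
      neg_one_zpow_congr (k * d.1) (by rw [hk]; ring)
    simp only [LinearMap.mk₂_apply, hfst]
    rw [par_of_mem hx, map_smul, LinearMap.smul_apply, hs]
    rfl
  · exact congrArg Prod.snd (lift_gen hQ h g)

end Ram

namespace BigradedOperad

variable {P : BigradedOperad.{u}}

theorem map_injective {I J : Type} [Finite I] [Finite J] (e : I ≃ J) :
    Function.Injective (P.map e) := by
  refine Function.LeftInverse.injective (g := P.map e.symm) fun x => ?_
  rw [← P.map_trans, Equiv.self_trans_symm, P.map_refl]

/-- A derivation vanishes on the unit, because the unit is idempotent. -/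
theorem IsDerivation.map_one {δ : ℤ × ℤ} {D : P.EndoFamily} (hD : P.IsDerivation δ D) :
    D Unit P.one = 0 := by
  -- Up to relabelling, `1 ∘ 1 = 1` gives `D 1 = D 1 ∘ 1 + 1 ∘ D 1`, and the last term is `D 1`.
  have h := hD.leibniz (x := P.map unitStar P.one) P.one (P.map_mem _ P.one_mem)
  rw [P.one_comp, P.one_comp, hD.map_map, hD.map_map, P.comp_one] at h
  simp only [Prod.fst_zero, mul_zero, zpow_zero, one_smul, right_eq_add] at h
  rw [← P.map_trans] at h
  exact map_injective _ (h.trans (map_zero _).symm)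

end BigradedOperad

namespace Ram

open CompSystem

/-- A derivation is determined by its values on the generators. -/
theorem derivation_ext {δ : ℤ × ℤ} {D D' : Ram.EndoFamily} (hD : Ram.IsDerivation δ D)
    (hD' : Ram.IsDerivation δ D') (h : ∀ g, D (Fin 2) (Ram.gen g) = D' (Fin 2) (Ram.gen g)) :
    D = D' := by
  funext I _
  refine LinearMap.ext fun x => ?_
  induction x using Ram.induction with
  | zero => simp only [map_zero]
  | add _ x y hx hy => simp only [map_add, hx, hy]
  | smul _ c x hx => simp only [map_smul, hx]
  | gen a => exact h a
  | one => rw [hD.map_one, hD'.map_one]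
  | map _ _ e x hx => rw [hD.map_map, hD'.map_map, hx]
  | comp _ _ d d' x y hdx _ hx hy => rw [hD.leibniz y hdx, hD'.leibniz y hdx, hx, hy]

/-- A derivation of odd first degree squares to zero when it does so on the generators. -/
theorem sq_eq_zero {δ : ℤ × ℤ} (hδ : Odd δ.1) {D : Ram.EndoFamily} (hD : Ram.IsDerivation δ D)
    (h : ∀ g, D (Fin 2) (D (Fin 2) (Ram.gen g)) = 0) {I : Type} [Finite I] (x : Ram.obj I) :
    D I (D I x) = 0 := by
  induction x using Ram.induction with
  | zero => simp only [map_zero]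
  | add _ x y hx hy => simp only [map_add, hx, hy, add_zero]
  | smul _ c x hx => simp only [map_smul, hx, smul_zero]
  | gen a => exact h a
  | one => rw [hD.map_one, map_zero]
  | map _ _ e x hx => rw [hD.map_map, hD.map_map, hx, map_zero]
  | comp _ _ d d' x y hdx _ hx hy =>
    rw [hD.leibniz y hdx, map_add, map_smul, hD.leibniz y (hD.map_mem hdx), hD.leibniz _ hdx,
      hx, hy, Prod.fst_add, mul_add, zpow_add₀ (by norm_num), (hδ.mul hδ).neg_one_zpow]
    simp

/-- A functional that is multiplicative for the composition, and vanishes on the images of the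
generators under a derivation, vanishes on all the images. -/
theorem counit_derivation {C : Ram.CoalgebraFamily} (hC : Ram.IsHopf C) {δ : ℤ × ℤ}
    {D : Ram.EndoFamily} (hD : Ram.IsDerivation δ D)
    (h : ∀ g, (C (Fin 2)).counit (D (Fin 2) (Ram.gen g)) = 0) {I : Type} [Finite I]
    (x : Ram.obj I) : (C I).counit (D I x) = 0 := by
  induction x using Ram.induction with
  | zero => simp only [map_zero]
  | add _ x y hx hy => simp only [map_add, hx, hy, add_zero]
  | smul _ c x hx => simp only [map_smul, hx, smul_zero]
  | gen a => exact h a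
  | one => rw [hD.map_one, map_zero]
  | map _ _ e x hx => rw [hD.map_map, hC.counit_map, hx]
  | comp _ _ d d' x y hdx _ hx hy =>
    rw [hD.leibniz y hdx, map_add, map_smul, hC.counit_comp, hC.counit_comp, hx, hy]
    simp

theorem par_E : Ram.sys.par (Fin 2) (Ram.gen .E) = Ram.gen .E := by
  rw [par_of_mem (satisfiesRel_gen.mem .E)]
  exact one_smul _ _

theorem par_L : Ram.sys.par (Fin 2) (Ram.gen .L) = Ram.gen .L := by
  rw [par_of_mem (satisfiesRel_gen.mem .L)]
  exact one_smul _ _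

theorem par_Ω : Ram.sys.par (Fin 2) (Ram.gen .Ω) = -Ram.gen .Ω := by
  rw [par_of_mem (satisfiesRel_gen.mem .Ω)]
  exact (congrArg (· • _) (zpow_one (-1 : ℂ))).trans (neg_one_smul _ _)

theorem exists_extendsD' : ∃ D', Ram.ExtendsD' D' := by
  have h := satisfiesRel_gen
  obtain ⟨D, hD, hθ⟩ := exists_isDerivation (1, 0) odd_one
    (fun | .E => 0 | .L => Ram.gen .Ω | .Ω => 0)
    { mem := fun
        | .E => ⟨h.mem .E, zero_mem _⟩
        | .L => ⟨h.mem .L, h.mem .Ω⟩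
        | .Ω => ⟨h.mem .Ω, zero_mem _⟩
      symm_E := Prod.ext h.symm_E (by simp)
      antisymm_L := Prod.ext h.antisymm_L h.antisymm_Ω
      antisymm_Ω := Prod.ext h.antisymm_Ω (by simp)
      jacobi := by
        rw [quad_squareZero, quad_squareZero, quad_squareZero, par_L]
        exact Prod.ext h.jacobi h.mixed
      mixed := by
        rw [quad_squareZero, quad_squareZero, quad_squareZero, quad_squareZero, quad_squareZero,
          quad_squareZero, par_Ω, par_L]
        -- The terms `Ω ∘ Ω` cancel because `Ω` is odd.
        exact Prod.ext h.mixed (by simp)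
      assoc := by
        rw [quad_squareZero, quad_squareZero]
        exact Prod.ext h.assoc (by simp)
      leibniz := by
        rw [quad_squareZero, quad_squareZero, quad_squareZero, par_E]
        exact Prod.ext h.leibniz (by simpa using h.bessel)
      bessel := by
        rw [quad_squareZero, quad_squareZero, quad_squareZero]
        exact Prod.ext h.bessel (by simp) }
  exact ⟨D, hD, hθ .E, hθ .L, hθ .Ω⟩

theorem exists_extendsD : ∃ D, Ram.ExtendsD D := by
  have h := satisfiesRel_gen
  obtain ⟨D, hD, hθ⟩ := exists_isDerivation (-1, 0) odd_neg_one
    (fun | .E => 0 | .L => 0 | .Ω => Ram.gen .L)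
    { mem := fun
        | .E => ⟨h.mem .E, zero_mem _⟩
        | .L => ⟨h.mem .L, zero_mem _⟩
        | .Ω => ⟨h.mem .Ω, h.mem .L⟩
      symm_E := Prod.ext h.symm_E (by simp)
      antisymm_L := Prod.ext h.antisymm_L (by simp)
      antisymm_Ω := Prod.ext h.antisymm_Ω h.antisymm_L
      jacobi := by
        rw [quad_squareZero, quad_squareZero, quad_squareZero]
        exact Prod.ext h.jacobi (by simp)
      mixed := by
        rw [quad_squareZero, quad_squareZero, quad_squareZero, quad_squareZero, quad_squareZero,
          quad_squareZero, par_L]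
        refine Prod.ext h.mixed ?_
        -- The second component is twice the Jacobi relation.
        refine Eq.trans ?_ ((congrArg₂ (· + ·) h.jacobi h.jacobi).trans (add_zero 0))
        simp only [map_zero, LinearMap.zero_apply, add_zero, zero_add, Prod.snd_add]
        abel
      assoc := by
        rw [quad_squareZero, quad_squareZero]
        exact Prod.ext h.assoc (by simp)
      leibniz := by
        rw [quad_squareZero, quad_squareZero, quad_squareZero]
        exact Prod.ext h.leibniz (by simp)
      bessel := by
        rw [quad_squareZero, quad_squareZero, quad_squareZero, par_E]
        exact Prod.ext h.bessel (by simpa using h.leibniz) }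
  exact ⟨D, hD, hθ .E, hθ .Ω, hθ .L⟩

end Ram

/-! ### The relations of `Ram` in its tensor square -/

namespace CompSystem

variable {A : CompSystem.{v}}

theorem map_quad (hA : A.IsOperad) (σ : Fin 3 ≃ Fin 3) (e : Unit ⊕ Fin 2 ≃ Fin 3)
    (a b : A.obj (Fin 2)) : A.map σ (A.quad e a b) = A.quad (e.trans σ) a b :=
  (hA.map_trans e σ _).symm

theorem quad_map_right (hA : A.IsOperad) (f : Fin 2 ≃ Fin 2) (e : Unit ⊕ Fin 2 ≃ Fin 3)
    (a b : A.obj (Fin 2)) :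
    A.quad e a (A.map f b) = A.quad ((Equiv.sumCongr (Equiv.refl Unit) f).trans e) a b := by
  have h := hA.comp_map (Equiv.refl Unit) f (A.map pairStar a) b
  rw [Equiv.optionCongr_refl, hA.map_refl] at h
  rw [quad_apply, h, ← hA.map_trans, quad_apply]

theorem tri_rotate_zero : (tri 0 1 2).trans (Equiv.addRight 1) = tri 1 2 0 := by
  ext x; revert x; decide

theorem tri_rotate_one : (tri 1 2 0).trans (Equiv.addRight 1) = tri 2 0 1 := by
  ext x; revert x; decide

theorem tri_rotate_two : (tri 2 0 1).trans (Equiv.addRight 1) = tri 0 1 2 := by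
  ext x; revert x; decide

theorem tri_swap :
    (Equiv.sumCongr (Equiv.refl Unit) (Equiv.swap 0 1)).trans (tri 1 2 0) = tri 1 0 2 := by
  ext x; revert x; decide

/-- The compatibility relation between an antisymmetric operation `x` and the product `m`, in terms
of cyclic permutations only. -/
theorem quad_leibniz (hA : A.IsOperad) {x m : A.obj (Fin 2)}
    (hx : A.map (Equiv.swap 0 1) x = -x)
    (h : A.quad (tri 0 1 2) x m = A.quad (tri 1 0 2) m x + A.quad (tri 2 0 1) m x) :
    A.quad (tri 0 1 2) x m = A.quad (tri 2 0 1) m x - A.quad (tri 1 2 0) m x ∧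
    A.quad (tri 1 2 0) x m = A.quad (tri 0 1 2) m x - A.quad (tri 2 0 1) m x ∧
    A.quad (tri 2 0 1) x m = A.quad (tri 1 2 0) m x - A.quad (tri 0 1 2) m x := by
  have h₀ : A.quad (tri 0 1 2) x m = A.quad (tri 2 0 1) m x - A.quad (tri 1 2 0) m x := by
    rw [h, ← tri_swap, ← quad_map_right hA, hx, map_neg]
    abel
  have h₁ := congrArg (A.map (Equiv.addRight 1)) h₀
  simp only [map_sub, map_quad hA, tri_rotate_zero, tri_rotate_one, tri_rotate_two] at h₁
  have h₂ := congrArg (A.map (Equiv.addRight 1)) h₁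
  simp only [map_sub, map_quad hA, tri_rotate_zero, tri_rotate_one, tri_rotate_two] at h₂
  exact ⟨h₀, h₁, h₂⟩

theorem quad_tensor {B : CompSystem.{w}} (e : Unit ⊕ Fin 2 ≃ Fin 3) {d d' : ℤ × ℤ}
    (x : A.obj (Fin 2)) {y : B.obj (Fin 2)} {x' : A.obj (Fin 2)} (y' : B.obj (Fin 2))
    (hy : y ∈ B.gr (Fin 2) d) (hx' : x' ∈ A.gr (Fin 2) d') (h : d.1 * d'.1 = 0) :
    (A.tensor B).quad e (x ⊗ₜ y) (x' ⊗ₜ y') = A.quad e x x' ⊗ₜ B.quad e y y' := by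
  refine (congrArg (TensorProduct.map (A.map e) (B.map e))
    (tensorComp_of_mem A B _ y' (B.map_mem pairStar hy) hx')).trans ?_
  rw [h, zpow_zero, one_smul]
  rfl

/-- The composition of two primitive operations. -/
theorem quad_primitive (e : Unit ⊕ Fin 2 ≃ Fin 3) {d d' : ℤ × ℤ} {m x y : A.obj (Fin 2)}
    (hm : m ∈ A.gr (Fin 2) 0) (hx : x ∈ A.gr (Fin 2) d) (hy : y ∈ A.gr (Fin 2) d')
    (h : d.1 * d'.1 = 0) :
    (A.tensor A).quad e (m ⊗ₜ[ℂ] x + x ⊗ₜ[ℂ] m) (m ⊗ₜ[ℂ] y + y ⊗ₜ[ℂ] m) =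
      A.quad e m m ⊗ₜ[ℂ] A.quad e x y + A.quad e m y ⊗ₜ[ℂ] A.quad e x m +
        A.quad e x m ⊗ₜ[ℂ] A.quad e m y + A.quad e x y ⊗ₜ[ℂ] A.quad e m m := by
  rw [map_add, map_add, LinearMap.add_apply, LinearMap.add_apply,
    quad_tensor e _ _ hx hm (mul_zero _), quad_tensor e _ _ hx hy h,
    quad_tensor e _ _ hm hm (mul_zero _),
    quad_tensor e _ _ hm hy (zero_mul _)]
  abel

/-- The compatibility of an operation `x` with a commutative associative product `m` passes to the
primitive operation `m ⊗ x + x ⊗ m` and the product `m ⊗ m`. -/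
theorem tensor_leibniz (hA : A.IsOperad) {d : ℤ × ℤ} {m x : A.obj (Fin 2)}
    (hm : m ∈ A.gr (Fin 2) 0) (hx : x ∈ A.gr (Fin 2) d) (hsymm : A.map (Equiv.swap 0 1) m = m)
    (hassoc : A.quad (tri 0 1 2) m m = A.quad (tri 1 2 0) m m)
    (h : A.quad (tri 0 1 2) x m = A.quad (tri 1 0 2) m x + A.quad (tri 2 0 1) m x) :
    (A.tensor A).quad (tri 0 1 2) (m ⊗ₜ[ℂ] x + x ⊗ₜ[ℂ] m) (m ⊗ₜ[ℂ] m) =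
      (A.tensor A).quad (tri 1 0 2) (m ⊗ₜ[ℂ] m) (m ⊗ₜ[ℂ] x + x ⊗ₜ[ℂ] m) +
        (A.tensor A).quad (tri 2 0 1) (m ⊗ₜ[ℂ] m) (m ⊗ₜ[ℂ] x + x ⊗ₜ[ℂ] m) := by
  have h₁ : A.quad (tri 1 0 2) m m = A.quad (tri 0 1 2) m m := by
    rw [← tri_swap, ← quad_map_right hA, hsymm, hassoc]
  have h₂ := congrArg (A.map (Equiv.addRight 1)) hassoc
  rw [map_quad hA, map_quad hA, tri_rotate_zero, tri_rotate_one, ← hassoc] at h₂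
  rw [map_add, map_add, map_add, LinearMap.add_apply, quad_tensor _ _ _ hx hm (mul_zero _),
    quad_tensor _ _ _ hm hm (mul_zero _), quad_tensor _ _ _ hm hm (mul_zero _),
    quad_tensor _ _ _ hm hx (zero_mul _), quad_tensor _ _ _ hm hm (mul_zero _),
    quad_tensor _ _ _ hm hx (zero_mul _), h, h₁, ← h₂, TensorProduct.tmul_add,
    TensorProduct.add_tmul]
  abel

/-- The values of the coproduct on the generators. -/
noncomputable def coproductGen (φ : Gen → A.obj (Fin 2)) : Gen → (A.tensor A).obj (Fin 2)
  | .E => φ .E ⊗ₜ φ .E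
  | .L => φ .E ⊗ₜ φ .L + φ .L ⊗ₜ φ .E
  | .Ω => φ .E ⊗ₜ φ .Ω + φ .Ω ⊗ₜ φ .E

/-- The relations of `Ram` hold for the values of the coproduct on the generators. -/
theorem SatisfiesRel.tensor (hA : A.IsOperad) {φ : Gen → A.obj (Fin 2)} (h : A.SatisfiesRel φ) :
    (A.tensor A).SatisfiesRel (coproductGen φ) := by
  obtain ⟨hL₀, hL₁, hL₂⟩ := quad_leibniz hA h.antisymm_L h.leibniz
  obtain ⟨hΩ₀, hΩ₁, hΩ₂⟩ := quad_leibniz hA h.antisymm_Ω h.bessel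
  have hE₁ := congrArg (A.map (Equiv.addRight 1)) h.assoc
  rw [map_quad hA, map_quad hA, tri_rotate_zero, tri_rotate_one] at hE₁
  have hE := h.mem .E
  have hL := h.mem .L
  have hΩ := h.mem .Ω
  constructor
  · rintro (_ | _ | _)
    · exact tmul_mem hE hE rfl
    · exact add_mem (tmul_mem hE hL rfl) (tmul_mem hL hE rfl)
    · exact add_mem (tmul_mem hE hΩ rfl) (tmul_mem hΩ hE rfl)
  · simp only [coproductGen, TensorProduct.map_tmul, h.symm_E]
  · simp only [coproductGen, map_add, TensorProduct.map_tmul, h.symm_E, h.antisymm_L,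
      TensorProduct.tmul_neg, TensorProduct.neg_tmul, neg_add]
  · simp only [coproductGen, map_add, TensorProduct.map_tmul, h.symm_E, h.antisymm_Ω,
      TensorProduct.tmul_neg, TensorProduct.neg_tmul, neg_add]
  · simp only [coproductGen]
    rw [quad_primitive _ hE hL hL rfl, quad_primitive _ hE hL hL rfl, quad_primitive _ hE hL hL rfl,
      hL₀, hL₁, hL₂, h.assoc, ← hE₁]
    -- The cyclic sum of the cross terms vanishes identically; the outer terms are these two.
    have h₁ := congrArg (A.quad (tri 1 2 0) (φ .E) (φ .E) ⊗ₜ[ℂ] ·) h.jacobi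
    have h₂ := congrArg (· ⊗ₜ[ℂ] A.quad (tri 1 2 0) (φ .E) (φ .E)) h.jacobi
    simp only [TensorProduct.tmul_add, TensorProduct.add_tmul, TensorProduct.tmul_zero,
      TensorProduct.zero_tmul, TensorProduct.tmul_sub, TensorProduct.sub_tmul] at h₁ h₂ ⊢
    linear_combination (norm := module) h₁ + h₂
  · simp only [coproductGen]
    rw [quad_primitive _ hE hL hΩ rfl, quad_primitive _ hE hL hΩ rfl, quad_primitive _ hE hL hΩ rfl,
      quad_primitive _ hE hΩ hL rfl, quad_primitive _ hE hΩ hL rfl, quad_primitive _ hE hΩ hL rfl,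
      hL₀, hL₁, hL₂, hΩ₀, hΩ₁, hΩ₂, h.assoc, ← hE₁]
    have h₁ := congrArg (A.quad (tri 1 2 0) (φ .E) (φ .E) ⊗ₜ[ℂ] ·) h.mixed
    have h₂ := congrArg (· ⊗ₜ[ℂ] A.quad (tri 1 2 0) (φ .E) (φ .E)) h.mixed
    simp only [TensorProduct.tmul_add, TensorProduct.add_tmul, TensorProduct.tmul_zero,
      TensorProduct.zero_tmul, TensorProduct.tmul_sub, TensorProduct.sub_tmul] at h₁ h₂ ⊢
    linear_combination (norm := module) h₁ + h₂
  · simp only [coproductGen]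
    rw [quad_tensor _ _ _ hE hE rfl, quad_tensor _ _ _ hE hE rfl, h.assoc]
  · exact tensor_leibniz hA hE hL h.symm_E h.assoc h.leibniz
  · exact tensor_leibniz hA hE hΩ h.symm_E h.assoc h.bessel

/-- The values of the counit on the generators. -/
noncomputable def counitGen : Gen → com.obj (Fin 2)
  | .E => (1 : ℂ)
  | .L => (0 : ℂ)
  | .Ω => (0 : ℂ)

theorem satisfiesRel_com : com.SatisfiesRel counitGen where
  mem
    | .E => Submodule.mem_top (R := ℂ) (M := ℂ)
    | .L => zero_mem _
    | .Ω => zero_mem _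
  symm_E := rfl
  antisymm_L := neg_zero.symm
  antisymm_Ω := neg_zero.symm
  jacobi := by simp [counitGen]
  mixed := by simp [counitGen]
  assoc := rfl
  leibniz := by simp [counitGen]
  bessel := by simp [counitGen]

end CompSystem

/-! ### The two forms of the composition of the tensor square -/

theorem BigradedOperad.tensorComp_tmul (P : BigradedOperad.{u}) {I J : Type} [Finite I] [Finite J]
    (s : P.obj (Option I) ⊗[ℂ] P.obj (Option I)) (t : P.obj J ⊗[ℂ] P.obj J) :
    P.tensorComp I J (s ⊗ₜ t) = CompSystem.tensorComp P.toCompSystem P.toCompSystem I J s t := by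
  induction s using CompSystem.tensor_induction (A := P.toCompSystem) (B := P.toCompSystem) with
  | add s s' hs hs' => rw [TensorProduct.add_tmul, map_add, map_add, LinearMap.add_apply, hs, hs']
  | tmul a b x hx y hy =>
    induction t using CompSystem.tensor_induction (A := P.toCompSystem)
      (B := P.toCompSystem) with
    | add t t' ht ht' => rw [TensorProduct.tmul_add, map_add, map_add, ht, ht']
    | tmul a' b' x' hx' y' hy' =>
      rw [P.tensorComp_of_mem x y' hy hx']
      exact (CompSystem.tensorComp_of_mem P.toCompSystem P.toCompSystem x y' hy hx').symm

/-! ### The coalgebra axioms on group-like and primitive elements -/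

section GroupLike

variable {M : Type v} [AddCommGroup M] [Module ℂ M] {Δ : M →ₗ[ℂ] M ⊗[ℂ] M} {ε : M →ₗ[ℂ] ℂ}
  {m x : M}

theorem coassoc_groupLike (hm : Δ m = m ⊗ₜ m) :
    TensorProduct.assoc ℂ M M M (TensorProduct.map Δ .id (Δ m)) =
      TensorProduct.map .id Δ (Δ m) := by
  simp [hm]

theorem coassoc_primitive (hm : Δ m = m ⊗ₜ m) (hx : Δ x = m ⊗ₜ x + x ⊗ₜ m) :
    TensorProduct.assoc ℂ M M M (TensorProduct.map Δ .id (Δ x)) =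
      TensorProduct.map .id Δ (Δ x) := by
  simp [hm, hx, TensorProduct.add_tmul, TensorProduct.tmul_add, add_assoc]

theorem counit_left_groupLike (hm : Δ m = m ⊗ₜ m) (hε : ε m = 1) :
    TensorProduct.map ε .id (Δ m) = 1 ⊗ₜ m := by
  simp [hm, hε]

theorem counit_left_primitive (hx : Δ x = m ⊗ₜ x + x ⊗ₜ m) (hε : ε m = 1) (hε' : ε x = 0) :
    TensorProduct.map ε .id (Δ x) = 1 ⊗ₜ x := by
  simp [hx, hε, hε']

theorem counit_right_groupLike (hm : Δ m = m ⊗ₜ m) (hε : ε m = 1) :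
    TensorProduct.map .id ε (Δ m) = m ⊗ₜ 1 := by
  simp [hm, hε]

theorem counit_right_primitive (hx : Δ x = m ⊗ₜ x + x ⊗ₜ m) (hε : ε m = 1) (hε' : ε x = 0) :
    TensorProduct.map .id ε (Δ x) = x ⊗ₜ 1 := by
  simp [hx, hε, hε']

end GroupLike

/-! ### The Hopf operad structure -/

namespace Ram

open CompSystem

/-- The coproduct of `Ram`. -/
noncomputable def comul (I : Type) [Finite I] : Ram.obj I →ₗ[ℂ] Ram.obj I ⊗[ℂ] Ram.obj I :=
  lift (isOperad_tensor Ram.isOperad_toCompSystem Ram.isOperad_toCompSystem)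
    (satisfiesRel_gen.tensor Ram.isOperad_toCompSystem) I

theorem isHom_comul : Ram.sys.IsHom (Ram.sys.tensor Ram.sys) comul :=
  isHom_lift (isOperad_tensor Ram.isOperad_toCompSystem Ram.isOperad_toCompSystem)
    (satisfiesRel_gen.tensor Ram.isOperad_toCompSystem)

theorem comul_E : comul (Fin 2) (Ram.gen .E) = Ram.gen .E ⊗ₜ Ram.gen .E := lift_gen _ _ .E

theorem comul_L : comul (Fin 2) (Ram.gen .L) =
    Ram.gen .E ⊗ₜ Ram.gen .L + Ram.gen .L ⊗ₜ Ram.gen .E := lift_gen _ _ .L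

theorem comul_Ω : comul (Fin 2) (Ram.gen .Ω) =
    Ram.gen .E ⊗ₜ Ram.gen .Ω + Ram.gen .Ω ⊗ₜ Ram.gen .E := lift_gen _ _ .Ω

/-- The counit of `Ram`. -/
noncomputable def counit (I : Type) [Finite I] : Ram.obj I →ₗ[ℂ] ℂ :=
  lift isOperad_com satisfiesRel_com I

theorem isHom_counit : Ram.sys.IsHom com counit := isHom_lift isOperad_com satisfiesRel_com

theorem counit_E : counit (Fin 2) (Ram.gen .E) = 1 := lift_gen isOperad_com satisfiesRel_com .E

theorem counit_L : counit (Fin 2) (Ram.gen .L) = 0 := lift_gen isOperad_com satisfiesRel_com .L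

theorem counit_Ω : counit (Fin 2) (Ram.gen .Ω) = 0 := lift_gen isOperad_com satisfiesRel_com .Ω

theorem comul_coassoc {I : Type} [Finite I] (x : Ram.obj I) :
    TensorProduct.assoc ℂ _ _ _ (TensorProduct.map (comul I) .id (comul I x)) =
      TensorProduct.map .id (comul I) (comul I x) := by
  refine hom_ext (isHom_comul.trans ((isHom_comul.tensor (isHom_id Ram.sys)).trans
    (isHom_assoc Ram.sys Ram.sys Ram.sys)))
    (isHom_comul.trans ((isHom_id Ram.sys).tensor isHom_comul)) (fun g => ?_) x
  cases g with
  | E => exact coassoc_groupLike comul_E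
  | L => exact coassoc_primitive comul_E comul_L
  | Ω => exact coassoc_primitive comul_E comul_Ω

theorem counit_left {I : Type} [Finite I] (x : Ram.obj I) :
    TensorProduct.map (counit I) .id (comul I x) = 1 ⊗ₜ x := by
  have h (g : Gen) : TensorProduct.map (counit (Fin 2)) .id (comul (Fin 2) (Ram.gen g)) =
      1 ⊗ₜ Ram.gen g := by
    cases g with
    | E => exact counit_left_groupLike comul_E counit_E
    | L => exact counit_left_primitive comul_L counit_E counit_L
    | Ω => exact counit_left_primitive comul_Ω counit_E counit_Ω
  exact hom_ext (isHom_comul.trans (isHom_counit.tensor (isHom_id Ram.sys)))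
    (isHom_one_tmul Ram.sys) h x

theorem counit_right {I : Type} [Finite I] (x : Ram.obj I) :
    TensorProduct.map .id (counit I) (comul I x) = x ⊗ₜ 1 := by
  have h (g : Gen) : TensorProduct.map .id (counit (Fin 2)) (comul (Fin 2) (Ram.gen g)) =
      Ram.gen g ⊗ₜ 1 := by
    cases g with
    | E => exact counit_right_groupLike comul_E counit_E
    | L => exact counit_right_primitive comul_L counit_E counit_L
    | Ω => exact counit_right_primitive comul_Ω counit_E counit_Ω
  exact hom_ext (isHom_comul.trans ((isHom_id Ram.sys).tensor isHom_counit))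
    (isHom_tmul_one Ram.sys) h x

/-- The coalgebra structures on the spaces of `Ram`. -/
noncomputable abbrev coalgebra : Ram.CoalgebraFamily := fun I _ =>
  { comul := comul I
    counit := counit I
    coassoc := LinearMap.ext comul_coassoc
    rTensor_counit_comp_comul := LinearMap.ext counit_left
    lTensor_counit_comp_comul := LinearMap.ext counit_right }

theorem extendsΔ_coalgebra : Ram.ExtendsΔ coalgebra := by
  refine ⟨?_, comul_E, comul_L, comul_Ω⟩
  exact
    { comul_mem := fun hx => isHom_comul.mem hx
      counit_eq_zero := fun {I _ d x} hx hd => by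
        have h : counit I x ∈ (if d = 0 then ⊤ else ⊥ : Submodule ℂ ℂ) := isHom_counit.mem hx
        rwa [if_neg hd, Submodule.mem_bot] at h
      comul_map := isHom_comul.map
      counit_map := isHom_counit.map
      comul_one := isHom_comul.one
      counit_one := isHom_counit.one
      comul_comp := fun x y => (isHom_comul.comp x y).trans (Ram.tensorComp_tmul _ _).symm
      counit_comp := isHom_counit.comp }

/-- The coproduct of a Hopf operad structure is a morphism to the tensor square. -/
theorem isHom_of_isHopf {C : Ram.CoalgebraFamily} (hC : Ram.IsHopf C) :
    Ram.sys.IsHom (Ram.sys.tensor Ram.sys) fun I _ => (C I).comul where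
  mem := hC.comul_mem
  map := hC.comul_map
  one := hC.comul_one
  comp x y := (hC.comul_comp x y).trans (Ram.tensorComp_tmul _ _)

end Ram

/-- The counit of a coalgebra is determined by the coproduct. -/
theorem coalgebra_ext {M : Type v} [AddCommGroup M] [Module ℂ M] {C C' : Coalgebra ℂ M}
    (h : C.comul = C'.comul) : C = C' := by
  have hε : C.counit = C'.counit := by
    refine LinearMap.ext fun x => ?_
    -- Both counits agree with `ε ⊗ ε'` applied to the common coproduct.
    have h₁ : TensorProduct.map C.counit C'.counit (C.comul x) = 1 ⊗ₜ C'.counit x := by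
      have := congrArg (LinearMap.lTensor ℂ C'.counit)
        (LinearMap.congr_fun C.rTensor_counit_comp_comul x)
      rwa [LinearMap.comp_apply, ← LinearMap.comp_apply, LinearMap.lTensor_comp_rTensor] at this
    have h₂ : TensorProduct.map C.counit C'.counit (C'.comul x) = C.counit x ⊗ₜ 1 := by
      have := congrArg (LinearMap.rTensor ℂ C.counit)
        (LinearMap.congr_fun C'.lTensor_counit_comp_comul x)
      rwa [LinearMap.comp_apply, ← LinearMap.comp_apply, LinearMap.rTensor_comp_lTensor] at this
    rw [← h, h₁] at h₂
    simpa using (congrArg (TensorProduct.lid ℂ ℂ) h₂).symm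
  obtain @⟨⟨Δ, ε⟩, _, _, _⟩ := C
  obtain @⟨⟨Δ', ε'⟩, _, _, _⟩ := C'
  cases h
  cases hε
  rfl

theorem Ram.extendsΔ_unique {C C' : Ram.CoalgebraFamily} (h : Ram.ExtendsΔ C)
    (h' : Ram.ExtendsΔ C') : C = C' := by
  funext I _
  refine coalgebra_ext (LinearMap.ext fun x => ?_)
  refine hom_ext (isHom_of_isHopf h.1) (isHom_of_isHopf h'.1) (fun g => ?_) x
  cases g with
  | E => exact h.2.1.trans h'.2.1.symm
  | L => exact h.2.2.1.trans h'.2.2.1.symm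
  | Ω => exact h.2.2.2.trans h'.2.2.2.symm

/-! ### Derivations and the coproduct -/

namespace BigradedOperad

variable {P : BigradedOperad.{u}}

theorem tensorEndo_tmul (D : P.EndoFamily) {I : Type} [Finite I] {d : ℤ × ℤ} {x : P.obj I}
    (hx : x ∈ P.gr I d) (y : P.obj I) :
    P.tensorEndo D I (x ⊗ₜ y) = D I x ⊗ₜ y + ((-1 : ℂ) ^ d.1) • (x ⊗ₜ[ℂ] D I y) := by
  rw [tensorEndo, LinearMap.add_apply, TensorProduct.map_tmul, TensorProduct.map_tmul,
    P.parity_of_mem hx, LinearMap.id_apply, ← TensorProduct.smul_tmul']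

theorem tensorEndo_leibniz_tmul {δ : ℤ × ℤ} (hδ : Odd δ.1) {D : P.EndoFamily}
    (hD : P.IsDerivation δ D) {I J : Type} [Finite I] [Finite J] {a b a' : ℤ × ℤ}
    {x y : P.obj (Option I)} {x' : P.obj J} (y' : P.obj J) (hx : x ∈ P.gr (Option I) a)
    (hy : y ∈ P.gr (Option I) b) (hx' : x' ∈ P.gr J a') :
    P.tensorEndo D (I ⊕ J) (P.tensorComp I J ((x ⊗ₜ y) ⊗ₜ (x' ⊗ₜ y'))) =
      P.tensorComp I J (P.tensorEndo D (Option I) (x ⊗ₜ y) ⊗ₜ (x' ⊗ₜ y')) +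
        ((-1 : ℂ) ^ (δ.1 * (a.1 + b.1))) •
          P.tensorComp I J ((x ⊗ₜ y) ⊗ₜ P.tensorEndo D J (x' ⊗ₜ y')) := by
  obtain ⟨k, hk⟩ := hδ
  rw [P.tensorComp_of_mem x y' hy hx', map_smul, tensorEndo_tmul D (P.comp_mem hx hx'),
    tensorEndo_tmul D hx, tensorEndo_tmul D hx', hD.leibniz _ hx, hD.leibniz _ hy]
  simp only [TensorProduct.tmul_add, TensorProduct.add_tmul, ← TensorProduct.smul_tmul',
    TensorProduct.tmul_smul, map_add, map_smul]
  rw [P.tensorComp_of_mem _ y' hy hx', P.tensorComp_of_mem _ y' (hD.map_mem hy) hx',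
    P.tensorComp_of_mem x y' hy (hD.map_mem hx'), P.tensorComp_of_mem x _ hy hx']
  simp only [smul_add, smul_smul, neg_one_zpow_mul, Prod.fst_add, hk]
  rw [neg_one_zpow_congr (a := b.1 * a'.1 + (2 * k + 1) * a.1)
      (b := (2 * k + 1) * (a.1 + b.1) + b.1 * (a'.1 + (2 * k + 1))) (-((2 * k + 1) * b.1))
      (by ring),
    neg_one_zpow_congr (a := b.1 * a'.1 + (a.1 + a'.1))
      (b := a.1 + (b.1 + (2 * k + 1)) * a'.1) (-(k * a'.1)) (by ring),
    neg_one_zpow_congr (a := b.1 * a'.1 + (a.1 + a'.1 + (2 * k + 1) * b.1))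
      (b := (2 * k + 1) * (a.1 + b.1) + (a'.1 + b.1 * a'.1)) (-(k * a.1)) (by ring)]
  abel

/-- If `D` is a derivation of odd first degree, so is `D ⊗ 1 + 1 ⊗ D`. -/
theorem tensorEndo_leibniz {δ : ℤ × ℤ} (hδ : Odd δ.1) {D : P.EndoFamily}
    (hD : P.IsDerivation δ D) {I J : Type} [Finite I] [Finite J] {d : ℤ × ℤ}
    {s : P.obj (Option I) ⊗[ℂ] P.obj (Option I)} (hs : s ∈ P.tensorGr (Option I) d)
    (t : P.obj J ⊗[ℂ] P.obj J) :
    P.tensorEndo D (I ⊕ J) (P.tensorComp I J (s ⊗ₜ t)) =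
      P.tensorComp I J (P.tensorEndo D (Option I) s ⊗ₜ t) +
        ((-1 : ℂ) ^ (δ.1 * d.1)) • P.tensorComp I J (s ⊗ₜ P.tensorEndo D J t) := by
  refine CompSystem.tensorGr_induction (A := P.toCompSystem) (B := P.toCompSystem)
    (p := fun s _ => P.tensorEndo D (I ⊕ J) (P.tensorComp I J (s ⊗ₜ t)) =
      P.tensorComp I J (P.tensorEndo D (Option I) s ⊗ₜ t) +
        ((-1 : ℂ) ^ (δ.1 * d.1)) • P.tensorComp I J (s ⊗ₜ P.tensorEndo D J t)) hs ?_ ?_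
  · intro s s' _ _ hs hs'
    simp only [TensorProduct.add_tmul, map_add, hs, hs', smul_add]
    abel
  · intro a b h x hx y hy
    induction t using CompSystem.tensor_induction (A := P.toCompSystem)
      (B := P.toCompSystem) with
    | add t t' ht ht' =>
      simp only [TensorProduct.tmul_add, map_add, ht, ht', smul_add]
      abel
    | tmul a' b' x' hx' y' hy' =>
      subst h
      exact tensorEndo_leibniz_tmul hδ hD y' hx hy hx'

/-- A derivation of odd first degree commutes with relabelling in the tensor square. -/
theorem tensorEndo_map {δ : ℤ × ℤ} {D : P.EndoFamily}
    (hD : P.IsDerivation δ D) {I J : Type} [Finite I] [Finite J] (e : I ≃ J)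
    (t : P.obj I ⊗[ℂ] P.obj I) :
    P.tensorEndo D J (TensorProduct.map (P.map e) (P.map e) t) =
      TensorProduct.map (P.map e) (P.map e) (P.tensorEndo D I t) := by
  induction t using CompSystem.tensor_induction (A := P.toCompSystem) (B := P.toCompSystem) with
  | add s t hs ht => simp only [map_add, hs, ht]
  | tmul a b x hx y hy =>
    rw [TensorProduct.map_tmul, tensorEndo_tmul D (P.map_mem e hx), tensorEndo_tmul D hx, map_add,
      map_smul, TensorProduct.map_tmul, TensorProduct.map_tmul, hD.map_map, hD.map_map]

end BigradedOperad

/-- A derivation of odd first degree is a coderivation when it is so on the generators. -/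
theorem Ram.isCoderivation {C : Ram.CoalgebraFamily} (hC : Ram.IsHopf C) {δ : ℤ × ℤ}
    (hδ : Odd δ.1) {D : Ram.EndoFamily} (hD : Ram.IsDerivation δ D)
    (h : ∀ g, (C (Fin 2)).comul (D (Fin 2) (Ram.gen g)) =
      Ram.tensorEndo D (Fin 2) ((C (Fin 2)).comul (Ram.gen g))) : Ram.IsCoderivation C D := by
  intro I _ x
  induction x using Ram.induction with
  | zero => simp only [map_zero]
  | add _ x y hx hy => simp only [map_add, hx, hy]
  | smul _ c x hx => simp only [map_smul, hx]
  | gen g => exact h g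
  | one =>
    rw [hC.comul_one, BigradedOperad.tensorEndo_tmul D Ram.one_mem, hD.map_one]
    simp
  | map _ _ e x hx => rw [hD.map_map, hC.comul_map, hC.comul_map, hx,
      BigradedOperad.tensorEndo_map hD]
  | comp _ _ d d' x y hdx _ hx hy =>
    rw [hD.leibniz y hdx, map_add, map_smul, hC.comul_comp, hC.comul_comp, hC.comul_comp, hx, hy,
      BigradedOperad.tensorEndo_leibniz hδ hD (hC.comul_mem hdx)]

end Ramanujan

theorem mainTheorem3 :
    (∃! D' : Ramanujan.Ram.EndoFamily, Ramanujan.Ram.ExtendsD' D') ∧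
    (∃! D : Ramanujan.Ram.EndoFamily, Ramanujan.Ram.ExtendsD D) ∧
    (∃! C : Ramanujan.Ram.CoalgebraFamily, Ramanujan.Ram.ExtendsΔ C) ∧
    (∀ (D' D : Ramanujan.Ram.EndoFamily) (C : Ramanujan.Ram.CoalgebraFamily),
      Ramanujan.Ram.ExtendsD' D' → Ramanujan.Ram.ExtendsD D → Ramanujan.Ram.ExtendsΔ C →
        Ramanujan.Ram.IsCoderivation C D' ∧ Ramanujan.Ram.IsCoderivation C D ∧
          Ramanujan.Ram.IsBidifferentialHopf C D' D) := by
  open Ramanujan Ram in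
  refine ⟨?_, ?_, ?_, ?_⟩
  · obtain ⟨D, hD⟩ := exists_extendsD'
    refine ⟨D, hD, fun D' hD' => derivation_ext hD'.1 hD.1 ?_⟩
    rintro (_ | _ | _)
    · exact hD'.2.1.trans hD.2.1.symm
    · exact hD'.2.2.1.trans hD.2.2.1.symm
    · exact hD'.2.2.2.trans hD.2.2.2.symm
  · obtain ⟨D, hD⟩ := exists_extendsD
    refine ⟨D, hD, fun D' hD' => derivation_ext hD'.1 hD.1 ?_⟩
    rintro (_ | _ | _)
    · exact hD'.2.1.trans hD.2.1.symm
    · exact hD'.2.2.2.trans hD.2.2.2.symm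
    · exact hD'.2.2.1.trans hD.2.2.1.symm
  · exact ⟨coalgebra, extendsΔ_coalgebra, fun C hC => extendsΔ_unique hC extendsΔ_coalgebra⟩
  · rintro D' D C ⟨hD', hE', hL', hΩ'⟩ ⟨hD, hE, hΩ, hL⟩ ⟨hC, hCE, hCL, hCΩ⟩
    have hgE : Ram.gen .E ∈ Ram.gr (Fin 2) (0, 0) := satisfiesRel_gen.mem .E
    have hgL : Ram.gen .L ∈ Ram.gr (Fin 2) (0, 1) := satisfiesRel_gen.mem .L
    have hgΩ : Ram.gen .Ω ∈ Ram.gr (Fin 2) (1, 1) := satisfiesRel_gen.mem .Ω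
    have hco' : Ram.IsCoderivation C D' := by
      refine isCoderivation hC odd_one hD' ?_
      rintro (_ | _ | _)
      · rw [hE', hCE, BigradedOperad.tensorEndo_tmul D' hgE, hE']
        simp
      · rw [hL', hCL, hCΩ, map_add, BigradedOperad.tensorEndo_tmul D' hgE,
          BigradedOperad.tensorEndo_tmul D' hgL, hE', hL']
        simp
      · rw [hΩ', hCΩ, map_add, BigradedOperad.tensorEndo_tmul D' hgE,
          BigradedOperad.tensorEndo_tmul D' hgΩ, hE', hΩ']
        simp
    have hco : Ram.IsCoderivation C D := by
      refine isCoderivation hC odd_neg_one hD ?_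
      rintro (_ | _ | _)
      · rw [hE, hCE, BigradedOperad.tensorEndo_tmul D hgE, hE]
        simp
      · rw [hL, hCL, map_add, BigradedOperad.tensorEndo_tmul D hgE,
          BigradedOperad.tensorEndo_tmul D hgL, hE, hL]
        simp
      · rw [hΩ, hCL, hCΩ, map_add, BigradedOperad.tensorEndo_tmul D hgE,
          BigradedOperad.tensorEndo_tmul D hgΩ, hE, hΩ]
        simp
    have hεL : (C (Fin 2)).counit (Ram.gen .L) = 0 := hC.counit_eq_zero hgL (by decide)
    have hεΩ : (C (Fin 2)).counit (Ram.gen .Ω) = 0 := hC.counit_eq_zero hgΩ (by decide)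
    refine ⟨hco', hco, ⟨hC, hD', hD, fun I _ => sq_eq_zero odd_one hD' ?_,
      fun I _ => sq_eq_zero odd_neg_one hD ?_, hD'.map_one, hD.map_one, hco', hco,
      fun I _ => counit_derivation hC hD' ?_, fun I _ => counit_derivation hC hD ?_⟩⟩
    · rintro (_ | _ | _)
      · rw [hE', map_zero]
      · rw [hL', hΩ']
      · rw [hΩ', map_zero]
    · rintro (_ | _ | _)
      · rw [hE, map_zero]
      · rw [hL, map_zero]
      · rw [hΩ, hL]
    · rintro (_ | _ | _)
      · rw [hE', map_zero]
      · rw [hL', hεΩ]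
      · rw [hΩ', map_zero]
    · rintro (_ | _ | _)
      · rw [hE, map_zero]
      · rw [hL, map_zero]
      · rw [hΩ, hεL]
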